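/- **Theorem (generalized canonical typicality, exponential bounds).** Let $\mathcal H_a$ and $\mathcal H_b$ be complex Hilbert spaces with $\mathcal H_a$ of finite dimension $d_a$ and $\mathcal H_b$ separable, and let $\rho$ be a density matrix (a positive operator with $\mathrm{tr}\,\rho=1$) on $\mathcal H=\mathcal H_a\otimes\mathcal H_b$. Write $\rho=\sum_n p_n|n\rangle\langle n|$ with an orthonormal eigenbasis $(|n\rangle)_n$; let $Z_n$ be independent complex Gaussian random variables with mean $0$ and $\mathbb E|Z_n|^2=p_n$ (real and imaginary parts independent, each of variance $p_n/2$), let $\mathrm G(\rho)$ be the law of $\sum_n Z_n|n\rangle$, let $\mathrm{GA}(\rho)(d\psi)=\|\psi\|^2\,\mathrm G(\rho)(d\psi)$, and let $\mathrm{GAP}(\rho)$ be the law of $\psi/\|\psi\|$ for $\psi\sim\mathrm{GA}(\rho)$, a measure on the unit sphere $\mathbb S(\mathcal H)$ with its Borel $\sigma$-algebra. For $\psi\in\mathbb S(\mathcal H)$ let $\rho_a^\psi=\mathrm{tr}_b|\psi\rangle\langle\psi|$, where $\mathrm{tr}_b$ is the partial trace over $\mathcal H_b$; let $\|M\|_{\mathrm{tr}}=\mathrm{tr}\sqrt{M^*M}$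 be the trace norm and $\|\rho\|$ the operator norm. Then $\mathrm{GAP}(\rho)$ is a probability measure and, for every $\delta>0$, $$\mathrm{GAP}(\rho)\Bigl\{\psi\in\mathbb S(\mathcal H):\ \bigl\|\rho_a^\psi-\mathrm{tr}_b\rho\bigr\|_{\mathrm{tr}}\le 48\pi\, d_a\sqrt{\ln\!\Bigl(\frac{12d_a^2}{\delta}\Bigr)\|\rho\|}\Bigr\}\ \ge\ 1-\delta$$ (for $\delta\ge1$ this is trivial; the square root of a negative number is read as $0$). Equivalently, for every $\varepsilon\ge0$, $$\mathrm{GAP}(\rho)\Bigl\{\psi\in\mathbb S(\mathcal H):\ \bigl\|\rho_a^\psi-\mathrm{tr}_b\rho\bigr\|_{\mathrm{tr}}>\varepsilon\Bigr\}\ \le\ 12\,d_a^2\exp\Bigl(-\frac{\tilde C\varepsilon^2}{d_a^2\|\rho\|}\Bigr),\qquad \tilde C=\frac1{2304\pi^2}.$$ -/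

import Mathlib

open MeasureTheory ProbabilityTheory
open scoped TensorProduct NNReal ENNReal

noncomputable section

namespace GAPTypicality

universe u v

section Hilbert

variable (H : Type u) [NormedAddCommGroup H] [InnerProductSpace ℂ H]

/-- A density matrix on `H`: a positive operator of trace `1`. (For a positive operator, the trace
`∑ i, ⟪b i, ρ (b i)⟫` does not depend on the orthonormal basis `b`.) -/
structure DensityMatrix where
  op : H →L[ℂ] H
  isPositive : op.IsPositive
  hasSum_trace : ∀ (s : Set H) (b : HilbertBasis s ℂ H), HasSum (fun i => inner ℂ (b i) (op (b i))) 1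

variable {H} [CompleteSpace H]

/-- A positive operator of finite trace is compact. -/
theorem DensityMatrix.isCompactOperator (ρ : DensityMatrix H) : IsCompactOperator ρ.op := by
  obtain ⟨w, b, -⟩ := exists_hilbertBasis ℂ H
  have hnn : (0 : H →L[ℂ] H) ≤ ρ.op :=
    (ContinuousLinearMap.nonneg_iff_isPositive ρ.op).2 ρ.isPositive
  set S : H →L[ℂ] H := CFC.sqrt ρ.op with hS
  have hSS : S * S = ρ.op := CFC.sqrt_mul_sqrt_self ρ.op hnn
  have hSpos : S.IsPositive :=
    (ContinuousLinearMap.nonneg_iff_isPositive S).1 (CFC.sqrt_nonneg ρ.op)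
  have hsym : ∀ x y : H, inner ℂ (S x) y = inner ℂ x (S y) := hSpos.inner_left_eq_inner_right
  have hsum : Summable (fun i => ‖S (b i)‖ ^ 2) := by
    have h := Complex.hasSum_re (ρ.hasSum_trace w b)
    refine h.summable.congr fun i => ?_
    rw [← hSS, show (S * S) (b i) = S (S (b i)) from rfl, ← hsym, inner_self_eq_norm_sq_to_K]
    norm_cast
  suffices hc : IsCompactOperator S by
    rw [← hSS]
    exact hc.clm_comp S
  let T : Finset w → (H →L[ℂ] H) := fun F => ∑ i ∈ F, InnerProductSpace.rankOne ℂ (b i) (S (b i))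
  have hT : ∀ F, IsCompactOperator (T F) := by
    intro F
    show T F ∈ compactOperator (RingHom.id ℂ) H H
    refine Submodule.sum_mem _ fun i _ => ?_
    show IsCompactOperator _
    exact (isCompactOperator_of_locallyCompactSpace_rng
      (ContinuousLinearMap.toSpanSingleton ℂ (b i))).comp_clm (innerSL ℂ (S (b i)))
  have hbound : ∀ F, ‖T F - S‖ ≤ √(∑' i : {i // i ∉ F}, ‖S (b i)‖ ^ 2) := by
    intro F
    refine ContinuousLinearMap.opNorm_le_bound _ (Real.sqrt_nonneg _) fun x => ?_
    have hpars := Complex.hasSum_re (b.hasSum_inner_mul_inner ((T F - S) x) ((T F - S) x))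
    have hcoef : ∀ i, (inner ℂ ((T F - S) x) (b i) * inner ℂ (b i) ((T F - S) x)).re
        ≤ (Set.indicator {i | i ∉ F} (fun i => ‖S (b i)‖ ^ 2) i) * ‖x‖ ^ 2 := by
      classical
      intro i
      have h1 : inner ℂ (b i) ((T F - S) x) = if i ∈ F then 0 else -inner ℂ (S (b i)) x := by
        simp only [T, sub_apply, sum_apply, InnerProductSpace.rankOne_apply,
          inner_sub_right, inner_sum, inner_smul_right, orthonormal_iff_ite.1 b.orthonormal, hsym]
        split_ifs with h <;> simp [h]
      have h2 : (inner ℂ ((T F - S) x) (b i) * inner ℂ (b i) ((T F - S) x)).re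
          = ‖inner ℂ (b i) ((T F - S) x)‖ ^ 2 := by
        rw [← inner_conj_symm ((T F - S) x) (b i), ← Complex.normSq_eq_conj_mul_self,
          Complex.ofReal_re, Complex.normSq_eq_norm_sq]
      rw [h2, h1]
      by_cases h : i ∈ F
      · simp [h]
      · simp only [h, if_false, norm_neg, Set.indicator, Set.mem_ofPred_eq, not_false_eq_true,
          if_true, ← mul_pow]
        gcongr
        exact norm_inner_le_norm _ _
    have hind : HasSum (Set.indicator {i | i ∉ F} (fun i => ‖S (b i)‖ ^ 2))
        (∑' i : {i // i ∉ F}, ‖S (b i)‖ ^ 2) :=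
      hasSum_subtype_iff_indicator.1 (hsum.subtype {i | i ∉ F}).hasSum
    have hle := hasSum_le hcoef hpars (hind.mul_right (‖x‖ ^ 2))
    rw [inner_self_eq_norm_sq_to_K] at hle
    have hle' : ‖(T F - S) x‖ ^ 2 ≤ (∑' i : {i // i ∉ F}, ‖S (b i)‖ ^ 2) * ‖x‖ ^ 2 := by
      refine le_trans (le_of_eq ?_) hle
      norm_cast
    have := Real.sqrt_le_sqrt hle'
    rwa [Real.sqrt_sq (norm_nonneg _), Real.sqrt_mul' _ (by positivity),
      Real.sqrt_sq (norm_nonneg _)] at this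
  refine isCompactOperator_of_tendsto (l := Filter.atTop) (F := T) ?_ (Filter.Eventually.of_forall hT)
  rw [tendsto_iff_norm_sub_tendsto_zero]
  refine squeeze_zero (fun _ => norm_nonneg _) hbound ?_
  have := (tendsto_tsum_compl_atTop_zero (fun i => ‖S (b i)‖ ^ 2)).sqrt
  simpa using this

open scoped ComplexOrder in
/-- Spectral theorem: a density matrix has an orthonormal eigenbasis, with eigenvalues `≥ 0`. -/
theorem DensityMatrix.exists_eigenbasis (ρ : DensityMatrix H) :
    ∃ (s : Set H) (b : HilbertBasis s ℂ H) (p : s → ℝ≥0),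
      ∀ n, ρ.op (b n) = ((p n : ℝ) : ℂ) • b n := by
  have hsymm : (ρ.op : H →ₗ[ℂ] H).IsSymmetric := ρ.isPositive.isSymmetric
  let E : ℂ → Submodule ℂ H := fun μ => Module.End.eigenspace (ρ.op : Module.End ℂ H) μ
  have hE : ∀ μ x, x ∈ E μ ↔ ρ.op x = μ • x := fun μ x => Module.End.mem_eigenspace_iff
  have hclosed : ∀ μ, IsClosed (E μ : Set H) := by
    intro μ
    have : (E μ : Set H) = {x | ρ.op x = μ • x} := by
      ext x
      exact hE μ x
    rw [this]
    exact isClosed_eq ρ.op.continuous (continuous_const_smul μ)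
  have : ∀ μ, CompleteSpace (E μ) := fun μ => (hclosed μ).completeSpace_coe
  choose w e _he using fun μ => exists_hilbertBasis ℂ (E μ)
  let v : (Σ μ : ℂ, w μ) → H := fun a => (e a.1 a.2 : H)
  have hv : Orthonormal ℂ v :=
    (LinearMap.IsSymmetric.orthogonalFamily_eigenspaces hsymm).orthonormal_sigma_orthonormal
      (fun μ => (e μ).orthonormal)
  have hbot : (Submodule.span ℂ (Set.range v))ᗮ = ⊥ := by
    rw [eq_bot_iff, ← ContinuousLinearMap.orthogonalComplement_iSup_eigenspaces_eq_bot
      ρ.isCompactOperator ρ.isPositive.isSymmetric]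
    intro x hx
    rw [← Submodule.iInf_orthogonal, Submodule.mem_iInf]
    intro μ
    rw [Submodule.mem_orthogonal]
    intro y hy
    have hsum := ((e μ).hasSum_repr ⟨y, hy⟩).mapL (E μ).subtypeL
    have hz := hsum.mapL (innerSL ℂ x)
    have h0 : ∀ i, innerSL ℂ x ((E μ).subtypeL ((e μ).repr ⟨y, hy⟩ i • e μ i)) = 0 := by
      intro i
      have : inner ℂ x (v ⟨μ, i⟩) = 0 :=
        Submodule.inner_left_of_mem_orthogonal (Submodule.subset_span (Set.mem_range_self _)) hx
      simp only [map_smul, innerSL_apply_apply, Submodule.subtypeL_apply, smul_eq_mul]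
      exact mul_eq_zero_of_right _ this
    simp only [h0] at hz
    have : inner ℂ x y = 0 := hz.unique hasSum_zero
    exact inner_eq_zero_symm.1 this
  have hbot' : (Submodule.span ℂ (Set.range ((↑) : Set.range v → H)))ᗮ = ⊥ := by
    rwa [Subtype.range_coe]
  have hev : ∀ n : Set.range v, ∃ p : ℝ≥0, ρ.op n = ((p : ℝ) : ℂ) • (n : H) := by
    rintro ⟨_, ⟨⟨μ, i⟩, rfl⟩⟩
    have h1 : ρ.op (v ⟨μ, i⟩) = μ • v ⟨μ, i⟩ := (hE μ _).1 (e μ i).2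
    have h2 := ρ.isPositive.inner_nonneg_right (v ⟨μ, i⟩)
    rw [h1, inner_smul_right, inner_self_eq_norm_sq_to_K, hv.1] at h2
    simp only [Complex.coe_algebraMap, Complex.ofReal_one, one_pow, mul_one] at h2
    obtain ⟨h4, h5⟩ := Complex.le_def.1 h2
    refine ⟨⟨μ.re, h4⟩, ?_⟩
    rw [h1]
    congr 1
    apply Complex.ext
    · rfl
    · exact h5.symm
  choose p hp using hev
  refine ⟨Set.range v, HilbertBasis.mkOfOrthogonalEqBot hv.toSubtypeRange hbot', p, fun n => ?_⟩
  rw [HilbertBasis.coe_mkOfOrthogonalEqBot]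
  exact hp n

/-- The index set of the eigenbasis `eigenbasis ρ`. -/
def DensityMatrix.eigenIndex (ρ : DensityMatrix H) : Set H := ρ.exists_eigenbasis.choose

/-- An orthonormal basis of eigenvectors `|n⟩` of `ρ`. -/
def DensityMatrix.eigenbasis (ρ : DensityMatrix H) : HilbertBasis ρ.eigenIndex ℂ H :=
  ρ.exists_eigenbasis.choose_spec.choose

/-- The eigenvalues `p n` of `ρ`, so that `ρ = ∑ n, p n |n⟩⟨n|`. -/
def DensityMatrix.eigenvalue (ρ : DensityMatrix H) : ρ.eigenIndex → ℝ≥0 :=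
  ρ.exists_eigenbasis.choose_spec.choose_spec.choose

theorem DensityMatrix.op_eigenbasis (ρ : DensityMatrix H) (n : ρ.eigenIndex) :
    ρ.op (ρ.eigenbasis n) = ((ρ.eigenvalue n : ℝ) : ℂ) • ρ.eigenbasis n :=
  ρ.exists_eigenbasis.choose_spec.choose_spec.choose_spec n

/-- The law of a complex Gaussian variable with mean `0` and variance `p`: the real and imaginary
parts are independent real Gaussians with mean `0` and variance `p / 2`. -/
def complexGaussian (p : ℝ≥0) : Measure ℂ :=
  ((gaussianReal 0 (p / 2)).prod (gaussianReal 0 (p / 2))).map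
    (fun x : ℝ × ℝ => (⟨x.1, x.2⟩ : ℂ))

variable [MeasurableSpace H]

/-- `G(ρ)`: the law of `∑ n, Z n • |n⟩` with independent complex Gaussians `Z n` with mean `0` and
variance `p n`. -/
def gaussianMeasure (ρ : DensityMatrix H) : Measure H :=
  (Measure.infinitePi fun n => complexGaussian (ρ.eigenvalue n)).map
    (fun z : ρ.eigenIndex → ℂ => ∑' n, z n • ρ.eigenbasis n)

/-- `GA(ρ)`: the measure with density `‖ψ‖ ^ 2` relative to `G(ρ)`. -/
def gaussianAdjusted (ρ : DensityMatrix H) : Measure H :=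
  (gaussianMeasure ρ).withDensity (fun ψ => ENNReal.ofReal (‖ψ‖ ^ 2))

/-- `GAP(ρ)`: the law of `ψ / ‖ψ‖` for `ψ` distributed according to `GA(ρ)`, as a measure on the
unit sphere. (`GA(ρ)` gives no mass to `0`, so that the law of `ψ / ‖ψ‖` lives on the sphere.) -/
def GAP (ρ : DensityMatrix H) : Measure (Metric.sphere (0 : H) 1) :=
  ((gaussianAdjusted ρ).map (fun ψ => ((‖ψ‖⁻¹ : ℝ) : ℂ) • ψ)).comap Subtype.val

end Hilbert

section Bipartite

variable {Ha : Type u} {Hb : Type v}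
  [NormedAddCommGroup Ha] [InnerProductSpace ℂ Ha] [FiniteDimensional ℂ Ha]
  [NormedAddCommGroup Hb] [InnerProductSpace ℂ Hb] [CompleteSpace Hb]

/-- Since `Ha` is finite-dimensional, the algebraic tensor product `Ha ⊗ Hb` with its canonical
inner product is complete, i.e. it is the Hilbert space tensor product. -/
instance instCompleteSpaceTensor : CompleteSpace (Ha ⊗[ℂ] Hb) := by
  let e := stdOrthonormalBasis ℂ Ha
  let n := Module.finrank ℂ Ha
  let f : (Ha ⊗[ℂ] Hb) →L[ℂ] (Fin n → Hb) := ContinuousLinearMap.pi fun i =>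
    (TensorProduct.lidIsometry ℂ Hb).toContinuousLinearEquiv.toContinuousLinearMap ∘L
      (ContinuousLinearMap.rTensor Hb (innerSL ℂ (e i)))
  let g : (Fin n → Hb) →L[ℂ] (Ha ⊗[ℂ] Hb) :=
    ∑ i, (TensorProduct.mkL ℂ Ha Hb (e i)) ∘L (ContinuousLinearMap.proj i)
  have hgf : Function.LeftInverse g f := by
    intro x
    induction x using TensorProduct.induction_on with
    | zero => simp
    | add x y hx hy => rw [map_add, map_add, hx, hy]
    | tmul x y =>
      have : g (f (x ⊗ₜ[ℂ] y)) = (∑ i, inner ℂ (e i) x • e i) ⊗ₜ[ℂ] y := by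
        simp only [f, g, TensorProduct.sum_tmul]
        simp [TensorProduct.smul_tmul]
      rw [this, e.sum_repr' x]
  have hfg : Function.RightInverse g f := by
    intro y
    funext i
    simp [f, g, orthonormal_iff_ite.1 e.orthonormal]
  let E : (Ha ⊗[ℂ] Hb) ≃L[ℂ] (Fin n → Hb) := ContinuousLinearEquiv.equivOfInverse f g hgf hfg
  exact E.isUniformEmbedding.isUniformInducing.completeSpace (by
    rw [E.surjective.range_eq]
    exact isComplete_univ)

/-- For `m : Hb`, the operator `φ ↦ φ ⊗ m` from `Ha` to `Ha ⊗ Hb`; its adjoint is the partial inner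
product with `m`. -/
def tensorRight (m : Hb) : Ha →L[ℂ] (Ha ⊗[ℂ] Hb) := (TensorProduct.mkL ℂ Ha Hb).flip m

/-- The partial trace `tr_b M = ∑ m, ⟨m|_b M |m⟩_b` over an orthonormal basis `m` of `Hb`, for a
trace-class operator `M`; the operator on `Ha` does not depend on the choice of the basis.
(The set chosen here is an orthonormal basis, its elements being the basis vectors.) -/
def partialTrace (M : (Ha ⊗[ℂ] Hb) →L[ℂ] (Ha ⊗[ℂ] Hb)) : Ha →L[ℂ] Ha :=
  ∑' m : (exists_hilbertBasis ℂ Hb).choose,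
    (ContinuousLinearMap.adjoint (tensorRight (m : Hb))) ∘L M ∘L (tensorRight (m : Hb))

/-- The reduced density matrix `tr_b |ψ⟩⟨ψ|`. -/
def reducedDensity (ψ : Ha ⊗[ℂ] Hb) : Ha →L[ℂ] Ha :=
  partialTrace (InnerProductSpace.rankOne ℂ ψ ψ)

/-- The trace norm `tr |M| = tr √(M* M)`. -/
def traceNorm (M : Ha →L[ℂ] Ha) : ℝ :=
  haveI : CompleteSpace Ha := FiniteDimensional.complete ℂ Ha
  (LinearMap.trace ℂ Ha (CFC.sqrt (star M * M) : Ha →L[ℂ] Ha)).re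

end Bipartite

end GAPTypicality

end

open MeasureTheory ProbabilityTheory
open scoped TensorProduct NNReal ENNReal

namespace GAPTypicality

/-! ### Exponential moments of real Gaussian quadratic forms -/

section GaussianQuadraticForm

/-! No concentration of measure on the sphere is needed: everything reduces to exponential moments
of Gaussian quadratic forms. For self-adjoint `D` with `‖ρ‖‖D‖ ≤ 1/2`, diagonalisation and `(1 -
x)^(-1/2) ≤ exp ((x + x²)/2)` give `E exp ⟪ψ, Dψ⟫ ≤ exp (tr ρD + ‖ρ‖‖D‖²)` under `G(ρ)`
(`lintegral_exp_inner_gaussianMeasure_le`).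

For `‖T‖ ≤ 1` and `β = Re tr ρT`, the event that `Re ⟪ψ, Tψ⟫` exceeds `β + s` after normalisation
reads `Re ⟪ψ, Tψ⟫ - (β + s)‖ψ‖² > 0` before it, which is again a quadratic form. The GAP weight is
absorbed by `‖ψ‖² ≤ exp (‖ψ‖² - 1)`, also the exponential of a quadratic form. A Chernoff bound thus
needs a single exponential moment, and optimising it gives the tail `3 exp (-s²/(128‖ρ‖))`
(`GAP_concentration`).

To pass to the trace norm, test `M = ρ_a^ψ - tr_b ρ` against the `d²` discrete Weyl operators `W` on
`H_a`, through `tr (W ρ_a^ψ) = ⟪ψ, (W ⊗ 1)ψ⟫`. If all `|tr (W M)| ≤ η`, Parseval bounds the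
Hilbert–Schmidt norm by `√d η`, hence the trace norm by `d η`
(`traceNorm_le_of_norm_trace_weyl_le`). A union bound over the Weyl operators and four phases gives
the prefactor `3 · 4 · d² = 12d²`. -/

lemma inv_sqrt_one_sub_le_exp {x : ℝ} (hx : |x| ≤ 1 / 2) :
    (√(1 - x))⁻¹ ≤ Real.exp ((x + x ^ 2) / 2) := by
  obtain ⟨hl, hu⟩ := abs_le.1 hx
  have h1 : 0 < 1 - x := by linarith
  have key : 1 ≤ (1 - x) * Real.exp (x + x ^ 2) := by
    -- For `x ≤ 0` the bound `1 + y ≤ exp y` suffices, as `(1 - x)(1 + x + x²) = 1 - x³ ≥ 1`. For `x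
    -- > 0` this falls below `1`, so the quadratic term of the exponential is needed.
    rcases le_total x 0 with h | h
    · have := Real.add_one_le_exp (x + x ^ 2)
      have h3 : (1 - x) * (x + x ^ 2 + 1) ≤ (1 - x) * Real.exp (x + x ^ 2) := by gcongr
      have h4 : (1 - x) * (x + x ^ 2 + 1) = 1 + (-x) ^ 3 := by ring
      have h5 : 0 ≤ (-x) ^ 3 := pow_nonneg (by linarith) 3
      linarith
    · have := Real.quadratic_le_exp_of_nonneg (x := x + x ^ 2) (by positivity)
      have h3 : (1 - x) * (1 + (x + x ^ 2) + (x + x ^ 2) ^ 2 / 2) ≤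
          (1 - x) * Real.exp (x + x ^ 2) := by gcongr
      have h4 : (1 - x) * (1 + (x + x ^ 2) + (x + x ^ 2) ^ 2 / 2) =
          1 + x ^ 2 / 2 * ((1 - 2 * x) + x * (1 - x - x ^ 2)) := by ring
      have h5 : 0 ≤ x ^ 2 / 2 * ((1 - 2 * x) + x * (1 - x - x ^ 2)) := by
        have : 0 ≤ 1 - x - x ^ 2 := by nlinarith
        have : 0 ≤ 1 - 2 * x := by linarith
        positivity
      linarith
  rw [inv_le_iff_one_le_mul₀ (by positivity), ← abs_of_pos (Real.exp_pos ((x + x ^ 2) / 2)),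
    ← Real.sqrt_sq_eq_abs, ← Real.sqrt_mul (by positivity), Real.one_le_sqrt, ← Real.exp_nat_mul]
  convert key using 1
  push_cast
  rw [mul_comm]
  congr 2
  ring

lemma lintegral_exp_mul_sq_gaussianReal {c : ℝ} (hc : c < 1) :
    ∫⁻ x, ENNReal.ofReal (Real.exp (c * x ^ 2 / 2)) ∂(gaussianReal 0 1) =
      ENNReal.ofReal (√(1 - c))⁻¹ := by
  have h1 : 0 < (1 - c) / 2 := by linarith
  rw [gaussianReal_of_var_ne_zero _ one_ne_zero,
    lintegral_withDensity_eq_lintegral_mul _ (measurable_gaussianPDF _ _) (by fun_prop)]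
  have h : ∀ x : ℝ, (gaussianPDF 0 1 * fun x => ENNReal.ofReal (Real.exp (c * x ^ 2 / 2))) x =
      ENNReal.ofReal ((√(2 * Real.pi))⁻¹ * Real.exp (-((1 - c) / 2) * x ^ 2)) := by
    intro x
    rw [Pi.mul_apply, gaussianPDF, ← ENNReal.ofReal_mul (gaussianPDFReal_nonneg _ _ _),
      gaussianPDFReal, mul_assoc, ← Real.exp_add]
    simp only [NNReal.coe_one, mul_one]
    congr 3
    ring
  simp_rw [h]
  rw [← ofReal_integral_eq_lintegral_ofReal ((integrable_exp_neg_mul_sq h1).const_mul _)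
    (ae_of_all _ fun x => by positivity), integral_const_mul, integral_gaussian,
    ← Real.sqrt_inv, ← Real.sqrt_inv, ← Real.sqrt_mul (by positivity)]
  congr 2
  have : (1 - c) ≠ 0 := by linarith
  field_simp

variable {E : Type*} [NormedAddCommGroup E] [InnerProductSpace ℝ E] [FiniteDimensional ℝ E]
  [MeasurableSpace E] [BorelSpace E]

/-- Bound for the exponential moment of a quadratic form of a standard Gaussian vector. -/
theorem lintegral_exp_quadraticForm_stdGaussian_le {ι : Type*} [Fintype ι]
    (v : OrthonormalBasis ι ℝ E) {K : E →ₗ[ℝ] E} (hK : K.IsSymmetric)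
    (hK' : ∀ x, ‖K x‖ ≤ 1 / 2 * ‖x‖) :
    ∫⁻ x, ENNReal.ofReal (Real.exp (inner ℝ x (K x) / 2)) ∂(stdGaussian E) ≤
      ENNReal.ofReal (Real.exp ((∑ i, inner ℝ (v i) (K (v i)) + ∑ i, ‖K (v i)‖ ^ 2) / 2)) := by
  have hn : Module.finrank ℝ E = Module.finrank ℝ E := rfl
  -- In an eigenbasis of `K` the coordinates of a standard Gaussian are independent standard
  -- normals, so the integral factorises. The two sums over `v` are `tr K` and `tr K²`, hence can be
  -- computed in the eigenbasis.
  set w := hK.eigenvectorBasis hn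
  set c := hK.eigenvalues hn
  have hw : ∀ i, K (w i) = c i • w i := fun i => hK.apply_eigenvectorBasis hn i
  have hc : ∀ i, |c i| ≤ 1 / 2 := by
    intro i
    have := hK' (w i)
    rw [hw, norm_smul, w.norm_eq_one, Real.norm_eq_abs] at this
    linarith
  have htr : ∑ i, inner ℝ (v i) (K (v i)) = ∑ i, c i := by
    rw [← LinearMap.trace_eq_sum_inner K v, LinearMap.trace_eq_sum_inner K w]
    simp [hw, inner_smul_right]
  have htr2 : ∑ i, ‖K (v i)‖ ^ 2 = ∑ i, c i ^ 2 := by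
    have h : ∀ x, ‖K x‖ ^ 2 = inner ℝ x ((K ∘ₗ K) x) := by
      intro x
      rw [← real_inner_self_eq_norm_sq, hK]
      rfl
    simp_rw [h]
    rw [← LinearMap.trace_eq_sum_inner (K ∘ₗ K) v, LinearMap.trace_eq_sum_inner (K ∘ₗ K) w]
    simp [hw, inner_smul_right, sq]
  have hquad : ∀ x : Fin (Module.finrank ℝ E) → ℝ,
      inner ℝ (∑ i, x i • w i) (K (∑ i, x i • w i)) = ∑ i, c i * x i ^ 2 := by
    intro x
    have : K (∑ i, x i • w i) = ∑ i, (x i * c i) • w i := by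
      simp [map_sum, hw, smul_smul]
    rw [this, w.orthonormal.inner_sum]
    simp only [conj_trivial]
    exact Finset.sum_congr rfl fun i _ => by ring
  have hmeas : Measurable fun x : E => ENNReal.ofReal (Real.exp (inner ℝ x (K x) / 2)) := by
    have : Continuous K := K.continuous_of_finiteDimensional
    fun_prop
  rw [stdGaussian_eq_map_pi_orthonormalBasis w, lintegral_map hmeas (by fun_prop)]
  simp_rw [hquad, Finset.sum_div, Real.exp_sum,
    ENNReal.ofReal_prod_of_nonneg fun _ _ => (Real.exp_pos _).le]
  rw [lintegral_prod_eq_prod_lintegral_of_indepFun Finset.univ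
    (fun i (x : Fin (Module.finrank ℝ E) → ℝ) => ENNReal.ofReal (Real.exp (c i * x i ^ 2 / 2)))
    (iIndepFun_pi (μ := fun _ => gaussianReal 0 1)
      (X := fun i x => ENNReal.ofReal (Real.exp (c i * x ^ 2 / 2))) fun i => by fun_prop)
    (fun i => by fun_prop)]
  have h1 : ∀ i, ∫⁻ x : Fin (Module.finrank ℝ E) → ℝ, ENNReal.ofReal (Real.exp (c i * x i ^ 2 / 2))
      ∂(Measure.pi fun _ => gaussianReal 0 1) ≤
        ENNReal.ofReal (Real.exp ((c i + c i ^ 2) / 2)) := by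
    intro i
    rw [(measurePreserving_eval (fun _ => gaussianReal 0 1) i).lintegral_comp
      (f := fun x => ENNReal.ofReal (Real.exp (c i * x ^ 2 / 2))) (by fun_prop),
      lintegral_exp_mul_sq_gaussianReal (by linarith [(abs_le.1 (hc i)).2])]
    exact ENNReal.ofReal_le_ofReal (inv_sqrt_one_sub_le_exp (hc i))
  refine (Finset.prod_le_prod' fun i _ => h1 i).trans_eq ?_
  rw [← ENNReal.ofReal_prod_of_nonneg fun _ _ => (Real.exp_pos _).le, ← Real.exp_sum, htr, htr2,
    ← Finset.sum_add_distrib, Finset.sum_div]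

end GaussianQuadraticForm

/-! ### Complex Gaussian vectors as real ones -/

section ComplexGaussian

instance (p : ℝ≥0) : IsProbabilityMeasure (complexGaussian p) := by
  have : Measurable (fun x : ℝ × ℝ => (⟨x.1, x.2⟩ : ℂ)) :=
    Complex.measurableEquivRealProd.symm.measurable
  exact Measure.isProbabilityMeasure_map this.aemeasurable

lemma charFun_complexGaussian (p : ℝ≥0) (t : ℂ) :
    charFun (complexGaussian p) t = Complex.exp (-(p : ℂ) * ‖t‖ ^ 2 / 4) := by
  have hm : Measurable (fun x : ℝ × ℝ => (⟨x.1, x.2⟩ : ℂ)) :=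
    Complex.measurableEquivRealProd.symm.measurable
  rw [charFun_apply, complexGaussian, integral_map hm.aemeasurable (by fun_prop)]
  have h : ∀ x : ℝ × ℝ, Complex.exp ((inner ℝ (⟨x.1, x.2⟩ : ℂ) t : ℝ) * Complex.I) =
      Complex.exp (t.re * x.1 * Complex.I) * Complex.exp (t.im * x.2 * Complex.I) := by
    intro x
    rw [← Complex.exp_add]
    congr 1
    simp [Complex.inner]
    ring
  simp_rw [h]
  rw [integral_prod_mul (f := fun x : ℝ => Complex.exp (t.re * x * Complex.I))
    (g := fun x : ℝ => Complex.exp (t.im * x * Complex.I)), ← charFun_apply_real,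
    ← charFun_apply_real, charFun_gaussianReal, charFun_gaussianReal, ← Complex.exp_add]
  congr 1
  rw [← Complex.ofReal_pow ‖t‖, Complex.sq_norm, Complex.normSq_apply]
  push_cast
  ring

lemma map_smul_complexGaussian (p q : ℝ≥0) :
    (complexGaussian q).map (fun z => ((√p : ℝ) : ℂ) * z) = complexGaussian (p * q) := by
  have : IsProbabilityMeasure ((complexGaussian q).map (fun z => ((√p : ℝ) : ℂ) * z)) :=
    Measure.isProbabilityMeasure_map (by fun_prop)
  apply Measure.ext_of_charFun
  ext t
  have h : (fun z : ℂ => ((√p : ℝ) : ℂ) * z) = fun z => (√p : ℝ) • z := by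
    ext z; simp
  rw [h, charFun_map_smul, charFun_complexGaussian, charFun_complexGaussian, norm_smul]
  congr 1
  have : ((√p : ℝ) : ℂ) ^ 2 = p := by
    rw [← Complex.ofReal_pow, Real.sq_sqrt p.coe_nonneg]
  rw [Real.norm_of_nonneg (Real.sqrt_nonneg _)]
  push_cast
  rw [mul_pow, this]
  ring

/-- Variance `2` is the normalisation in which real and imaginary parts each have variance `1`. -/
lemma map_toLp_pi_complexGaussian {F : Type*} [Fintype F] :
    (Measure.pi fun _ : F => complexGaussian 2).map (WithLp.toLp 2) =
      stdGaussian (PiLp 2 fun _ : F => ℂ) := by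
  have : IsProbabilityMeasure ((Measure.pi fun _ : F => complexGaussian 2).map (WithLp.toLp 2)) :=
    Measure.isProbabilityMeasure_map (by fun_prop)
  apply Measure.ext_of_charFun (E := PiLp 2 fun _ : F => ℂ)
  ext t
  rw [charFun_pi, charFun_stdGaussian]
  simp_rw [charFun_complexGaussian, ← Complex.exp_sum]
  congr 1
  rw [← Complex.ofReal_pow, PiLp.norm_sq_eq_of_L2]
  push_cast
  rw [← Finset.sum_div, neg_div, ← Finset.mul_sum]
  ring

lemma complexGaussian_eq_map (p : ℝ≥0) :
    complexGaussian p = (complexGaussian 2).map (fun z => ((√(p / 2) : ℝ) : ℂ) * z) := by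
  have := map_smul_complexGaussian (p / 2) 2
  rw [div_mul_cancel₀ _ two_ne_zero] at this
  rw [← this]
  simp

variable {H : Type*} [NormedAddCommGroup H] [InnerProductSpace ℂ H] [CompleteSpace H]

/-- The random vector is the image of a real standard Gaussian under a real-linear map `L` with
`‖L‖² ≤ r/2`, so the real bound applies to `K = 2 L* D L`, whose norm is at most `r‖D‖`. Each `e n`
contributes two real directions, which cancels the factor `1/2` in that bound. -/
theorem lintegral_exp_inner_sum_complexGaussian_le {F : Type*} [Fintype F] {e : F → H}
    (he : Orthonormal ℂ e) (p : F → ℝ≥0) {r : ℝ} (hp : ∀ n, p n ≤ r) (hr : 0 ≤ r)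
    {D : H →L[ℂ] H} (hD : (D : H →ₗ[ℂ] H).IsSymmetric) (hrD : r * ‖D‖ ≤ 1 / 2) :
    ∫⁻ z, ENNReal.ofReal (Real.exp (inner ℂ (∑ n, z n • e n) (D (∑ n, z n • e n))).re)
        ∂(Measure.pi fun n => complexGaussian (p n)) ≤
      ENNReal.ofReal (Real.exp
        (∑ n, p n * (inner ℂ (e n) (D (e n))).re + r * ‖D‖ ^ 2 * ∑ n, (p n : ℝ))) := by
  classical
  let a : F → ℝ := fun n => √(p n / 2)
  have ha : ∀ n, a n ^ 2 = p n / 2 := fun n => Real.sq_sqrt (by positivity)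
  let L : (PiLp 2 fun _ : F => ℂ) →L[ℝ] H := LinearMap.toContinuousLinearMap
    { toFun := fun x => ∑ n, ((a n : ℂ) * x n) • e n
      map_add' := fun x y => by
        simp [mul_add, add_smul, Finset.sum_add_distrib]
      map_smul' := fun c x => by
        simp only [PiLp.smul_apply, Complex.real_smul, RingHom.id_apply, Finset.smul_sum]
        refine Finset.sum_congr rfl fun n _ => ?_
        rw [← Complex.coe_smul, smul_smul]
        congr 1
        ring }
  have hL : ∀ x, L x = ∑ n, ((a n : ℂ) * x n) • e n := fun _ => rfl
  have hLnorm : ∀ x, ‖L x‖ ^ 2 ≤ r / 2 * ‖x‖ ^ 2 := by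
    intro x
    rw [hL, PiLp.norm_sq_eq_of_L2, ← Complex.ofReal_re (‖_‖ ^ 2), Complex.ofReal_pow,
      ← Complex.coe_algebraMap, ← inner_self_eq_norm_sq_to_K (𝕜 := ℂ), he.inner_sum, Finset.mul_sum,
      Complex.re_sum]
    refine Finset.sum_le_sum fun n _ => ?_
    rw [← Complex.normSq_eq_conj_mul_self, Complex.ofReal_re, Complex.normSq_eq_norm_sq, norm_mul,
      mul_pow, Complex.coe_algebraMap, Complex.norm_real, Real.norm_eq_abs, sq_abs, ha]
    have := hp n
    gcongr
  have hLop : ‖L‖ ≤ √(r / 2) := by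
    refine L.opNorm_le_bound (Real.sqrt_nonneg _) fun x => ?_
    refine abs_le_of_sq_le_sq' ?_ (by positivity) |>.2
    rw [mul_pow, Real.sq_sqrt (by positivity)]
    exact hLnorm x
  let DR : H →L[ℝ] H := D.restrictScalars ℝ
  -- `L` is only used as a real-linear map, so its adjoint is taken for the real part of the inner
  -- product.
  let _ : InnerProductSpace ℝ H := InnerProductSpace.rclikeToReal ℂ H
  let Ladj : H →L[ℝ] (PiLp 2 fun _ : F => ℂ) :=
    ContinuousLinearMap.adjoint (𝕜 := ℝ) (E := PiLp 2 fun _ : F => ℂ) (F := H) L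
  have hLadj : ∀ x y, inner ℝ x (Ladj y) = inner ℝ (L x) y := fun x y =>
    ContinuousLinearMap.adjoint_inner_right L x y
  have hLadj_norm : ‖Ladj‖ ≤ √(r / 2) := by
    rwa [LinearIsometryEquiv.norm_map]
  let K : (PiLp 2 fun _ : F => ℂ) →L[ℝ] (PiLp 2 fun _ : F => ℂ) :=
    (2 : ℝ) • (Ladj ∘L DR ∘L L)
  have hKin : ∀ x y, inner ℝ x (K y) = 2 * (inner ℂ (L x) (D (L y))).re := by
    intro x y
    simp only [K, FunLike.coe_smul, Pi.smul_apply, inner_smul_right, ContinuousLinearMap.comp_apply,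
      hLadj]
    rfl
  have hKsymm : (K : (PiLp 2 fun _ : F => ℂ) →ₗ[ℝ] (PiLp 2 fun _ : F => ℂ)).IsSymmetric := by
    intro x y
    simp only [ContinuousLinearMap.coe_coe]
    have h := hD (L y) (L x)
    simp only [ContinuousLinearMap.coe_coe] at h
    rw [hKin, real_inner_comm, hKin, ← h, ← inner_conj_symm, Complex.conj_re]
  have hKnorm : ∀ x, ‖K x‖ ≤ 2 * (√(r / 2) * (‖D‖ * ‖L x‖)) := by
    intro x
    simp only [K, FunLike.coe_smul, Pi.smul_apply, norm_smul, ContinuousLinearMap.comp_apply]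
    rw [Real.norm_of_nonneg zero_le_two]
    gcongr
    refine (Ladj.le_opNorm _).trans ?_
    gcongr
    exact D.le_opNorm _
  have hKhalf : ∀ x, ‖K x‖ ≤ 1 / 2 * ‖x‖ := by
    intro x
    refine (hKnorm x).trans ?_
    calc 2 * (√(r / 2) * (‖D‖ * ‖L x‖)) ≤ 2 * (√(r / 2) * (‖D‖ * (√(r / 2) * ‖x‖))) := by
          gcongr
          exact (L.le_opNorm x).trans (by gcongr)
      _ = 2 * (√(r / 2) ^ 2) * ‖D‖ * ‖x‖ := by ring
      _ = r * ‖D‖ * ‖x‖ := by rw [Real.sq_sqrt (by positivity)]; ring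
      _ ≤ _ := by gcongr
  let v := Pi.orthonormalBasis (𝕜 := ℝ) (fun _ : F => Complex.orthonormalBasisOneI)
  have hLv : ∀ n k, L (v ⟨n, k⟩) = ((a n : ℂ) * Complex.orthonormalBasisOneI k) • e n := by
    intro n k
    rw [hL, Finset.sum_eq_single n]
    · simp [v, Pi.orthonormalBasis_apply]
    · intro m _ hmn
      simp [v, Pi.orthonormalBasis_apply, hmn]
    · simp
  have hu : ∀ k, ‖Complex.orthonormalBasisOneI k‖ = 1 := Complex.orthonormalBasisOneI.norm_eq_one
  have hin : ∀ n k, inner ℝ (v ⟨n, k⟩) (K (v ⟨n, k⟩)) = p n * (inner ℂ (e n) (D (e n))).re := by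
    intro n k
    rw [hKin, hLv, map_smul, inner_smul_left, inner_smul_right, ← mul_assoc,
      ← Complex.normSq_eq_conj_mul_self, Complex.re_ofReal_mul, Complex.normSq_eq_norm_sq, norm_mul,
      hu, mul_one, Complex.norm_real, Real.norm_eq_abs, sq_abs, ha]
    ring
  have hsq : ∀ n k, ‖K (v ⟨n, k⟩)‖ ^ 2 ≤ r * ‖D‖ ^ 2 * p n := by
    intro n k
    have h1 : ‖L (v ⟨n, k⟩)‖ ^ 2 = p n / 2 := by
      rw [hLv, norm_smul, he.1, norm_mul, hu, mul_one, mul_one, Complex.norm_real,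
        Real.norm_eq_abs, sq_abs, ha]
    calc ‖K (v ⟨n, k⟩)‖ ^ 2 ≤ (2 * (√(r / 2) * (‖D‖ * ‖L (v ⟨n, k⟩)‖))) ^ 2 := by
          gcongr
          exact hKnorm _
      _ = 4 * √(r / 2) ^ 2 * ‖D‖ ^ 2 * ‖L (v ⟨n, k⟩)‖ ^ 2 := by ring
      _ = _ := by rw [h1, Real.sq_sqrt (by positivity)]; ring
  have hpi : (Measure.pi fun n => complexGaussian (p n)) =
      (Measure.pi fun _ : F => complexGaussian 2).map (fun x n => (a n : ℂ) * x n) := by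
    have : ∀ n, IsProbabilityMeasure ((complexGaussian 2).map (fun z => (a n : ℂ) * z)) :=
      fun n => Measure.isProbabilityMeasure_map (by fun_prop)
    rw [Measure.pi_map_pi (μ := fun _ : F => complexGaussian 2)
      (f := fun n z => (a n : ℂ) * z) (fun n => by fun_prop)]
    simp_rw [a, ← complexGaussian_eq_map]
  have hmeas : Measurable fun z : F → ℂ =>
      ENNReal.ofReal (Real.exp (inner ℂ (∑ n, z n • e n) (D (∑ n, z n • e n))).re) := by
    have : Continuous fun z : F → ℂ =>
      Real.exp (inner ℂ (∑ n, z n • e n) (D (∑ n, z n • e n))).re := by fun_prop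
    exact this.measurable.ennreal_ofReal
  have hmain := lintegral_exp_quadraticForm_stdGaussian_le v hKsymm hKhalf
  rw [← map_toLp_pi_complexGaussian, lintegral_map (by fun_prop) (by fun_prop)] at hmain
  rw [hpi, lintegral_map hmeas (by fun_prop)]
  refine le_trans (le_of_eq ?_) (hmain.trans ?_)
  · refine lintegral_congr fun x => ?_
    simp only [ContinuousLinearMap.coe_coe]
    rw [hKin, hL]
    congr 2
    ring
  · refine ENNReal.ofReal_le_ofReal (Real.exp_le_exp.2 ?_)
    simp only [ContinuousLinearMap.coe_coe, Fintype.sum_sigma, hin]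
    have h2 : ∑ n, ∑ k, ‖K (v ⟨n, k⟩)‖ ^ 2 ≤ ∑ n, ∑ _k : Fin 2, r * ‖D‖ ^ 2 * p n :=
      Finset.sum_le_sum fun n _ => Finset.sum_le_sum fun k _ => hsq n k
    simp only [Finset.sum_const, Finset.card_univ, Fintype.card_fin, nsmul_eq_mul,
      Nat.cast_ofNat, ← Finset.mul_sum] at h2 ⊢
    linarith

end ComplexGaussian

/-! ### Second moments -/

section Moments

lemma lintegral_sq_gaussianReal (v : ℝ≥0) :
    ∫⁻ x, ENNReal.ofReal (x ^ 2) ∂(gaussianReal 0 v) = v := by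
  have hL : MemLp id 2 (gaussianReal 0 v) := memLp_id_gaussianReal 2
  have h := variance_fun_id_gaussianReal (μ := 0) (v := v)
  rw [variance_eq_integral (by fun_prop)] at h
  simp only [integral_id_gaussianReal, sub_zero] at h
  have hI : Integrable (fun x : ℝ => x ^ 2) (gaussianReal 0 v) := hL.integrable_sq
  rw [← ofReal_integral_eq_lintegral_ofReal hI (ae_of_all _ fun x => sq_nonneg x)]
  rw [h, ENNReal.ofReal_coe_nnreal]

lemma lintegral_norm_sq_complexGaussian (p : ℝ≥0) :
    ∫⁻ z, ENNReal.ofReal (‖z‖ ^ 2) ∂(complexGaussian p) = p := by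
  have hm : Measurable (fun x : ℝ × ℝ => (⟨x.1, x.2⟩ : ℂ)) :=
    Complex.measurableEquivRealProd.symm.measurable
  rw [complexGaussian, lintegral_map (by fun_prop) hm]
  have h : ∀ x : ℝ × ℝ, ENNReal.ofReal (‖(⟨x.1, x.2⟩ : ℂ)‖ ^ 2) =
      ENNReal.ofReal (x.1 ^ 2) + ENNReal.ofReal (x.2 ^ 2) := by
    intro x
    rw [← ENNReal.ofReal_add (sq_nonneg _) (sq_nonneg _), Complex.sq_norm, Complex.normSq_apply]
    simp [sq]
  simp_rw [h]
  rw [lintegral_add_left (by fun_prop),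
    measurePreserving_fst.lintegral_comp (f := fun x => ENNReal.ofReal (x ^ 2)) (by fun_prop),
    measurePreserving_snd.lintegral_comp (f := fun x => ENNReal.ofReal (x ^ 2)) (by fun_prop),
    lintegral_sq_gaussianReal, ← ENNReal.coe_add, add_halves]

end Moments

/-! ### The Gaussian measure on Hilbert space -/

section Hilbert

variable {H : Type*} [NormedAddCommGroup H] [InnerProductSpace ℂ H]

/-- Orthonormal vectors lie `√2` apart, so balls of radius `1/2` around them are disjoint open sets
in a separable space. -/
lemma countable_of_orthonormal [TopologicalSpace.SeparableSpace H] {ι : Type*} {b : ι → H}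
    (hb : Orthonormal ℂ b) : Countable ι := by
  have hdist : ∀ i j, i ≠ j → 1 ≤ dist (b i) (b j) := by
    intro i j hij
    rw [dist_eq_norm]
    have h : ‖b i - b j‖ ^ 2 = 2 := by
      rw [@norm_sub_sq ℂ, hb.1, hb.1, hb.2 hij]
      simp
      norm_num
    nlinarith [norm_nonneg (b i - b j)]
  have hdisj : (Set.univ : Set ι).PairwiseDisjoint fun i => Metric.ball (b i) (1 / 2) := by
    intro i _ j _ hij
    exact Metric.ball_disjoint_ball (by linarith [hdist i j hij])
  exact Set.countable_univ_iff.1 (hdisj.countable_of_isOpen (fun _ _ => Metric.isOpen_ball)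
    fun i _ => ⟨b i, Metric.mem_ball_self (by norm_num)⟩)

lemma hilbertBasis_summable_smul {ι : Type*} (b : HilbertBasis ι ℂ H) {z : ι → ℂ}
    (hz : Summable fun n => ‖z n‖ ^ 2) :
    Summable (fun n => z n • b n) ∧ ‖∑' n, z n • b n‖ ^ 2 = ∑' n, ‖z n‖ ^ 2 := by
  have hmem : Memℓp z 2 := memℓp_gen (by simpa using hz)
  let f : lp (fun _ : ι => ℂ) 2 := ⟨z, hmem⟩
  have h : HasSum (fun n => z n • b n) (b.repr.symm f) := b.hasSum_repr_symm f
  refine ⟨h.summable, ?_⟩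
  rw [h.tsum_eq, LinearIsometryEquiv.norm_map]
  have := lp.norm_rpow_eq_tsum (p := 2) (by simp) f
  simpa using this

variable [CompleteSpace H] (ρ : DensityMatrix H)

lemma DensityMatrix.hasSum_eigenvalue : HasSum (fun n => (ρ.eigenvalue n : ℝ)) 1 := by
  have h := Complex.hasSum_re (ρ.hasSum_trace _ ρ.eigenbasis)
  simpa [ρ.op_eigenbasis, inner_smul_right, inner_self_eq_norm_sq_to_K,
    ρ.eigenbasis.orthonormal.1] using h

lemma DensityMatrix.eigenvalue_le_norm (n : ρ.eigenIndex) : (ρ.eigenvalue n : ℝ) ≤ ‖ρ.op‖ := by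
  have h := ρ.op.le_opNorm (ρ.eigenbasis n)
  rw [ρ.op_eigenbasis, norm_smul, ρ.eigenbasis.orthonormal.1] at h
  simpa using h

lemma DensityMatrix.norm_op_pos : 0 < ‖ρ.op‖ := by
  rw [norm_pos_iff]
  intro h
  have h0 : ∀ n, (ρ.eigenvalue n : ℝ) = 0 := fun n =>
    le_antisymm (by simpa [h] using ρ.eigenvalue_le_norm n) (NNReal.coe_nonneg _)
  have := ρ.hasSum_eigenvalue
  simp only [h0] at this
  exact one_ne_zero (this.unique hasSum_zero)

/-- The law of the independent Gaussian coefficients `Z n`. -/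
noncomputable abbrev coefficientMeasure : Measure (ρ.eigenIndex → ℂ) :=
  Measure.infinitePi fun n => complexGaussian (ρ.eigenvalue n)

variable [TopologicalSpace.SeparableSpace H]

instance : Countable ρ.eigenIndex := countable_of_orthonormal ρ.eigenbasis.orthonormal

/-- By Tonelli this is `∑ p n = tr ρ`. Its finiteness yields almost sure convergence of `∑ Z n |n⟩`;
its value normalises `GA(ρ)`. -/
lemma lintegral_tsum_norm_sq_coefficient :
    ∫⁻ z, ∑' n, ENNReal.ofReal (‖z n‖ ^ 2) ∂(coefficientMeasure ρ) = 1 := by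
  rw [lintegral_tsum fun n => Measurable.aemeasurable (by fun_prop)]
  have h : ∀ n, ∫⁻ z, ENNReal.ofReal (‖z n‖ ^ 2) ∂(coefficientMeasure ρ) =
      ENNReal.ofReal (ρ.eigenvalue n) := by
    intro n
    rw [(measurePreserving_eval_infinitePi _ n).lintegral_comp
      (f := fun z => ENNReal.ofReal (‖z‖ ^ 2)) (by fun_prop), lintegral_norm_sq_complexGaussian,
      ENNReal.ofReal_coe_nnreal]
  simp_rw [h]
  rw [← ENNReal.ofReal_tsum_of_nonneg (fun n => NNReal.coe_nonneg _) ρ.hasSum_eigenvalue.summable,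
    ρ.hasSum_eigenvalue.tsum_eq, ENNReal.ofReal_one]

lemma ae_summable_norm_sq_coefficient :
    ∀ᵐ z ∂(coefficientMeasure ρ), Summable fun n => ‖z n‖ ^ 2 := by
  have h := ae_lt_top (μ := coefficientMeasure ρ)
    (f := fun z => ∑' n, ENNReal.ofReal (‖z n‖ ^ 2)) (by fun_prop)
    (by rw [lintegral_tsum_norm_sq_coefficient]; exact ENNReal.one_ne_top)
  filter_upwards [h] with z hz
  have := ENNReal.summable_toReal hz.ne
  simpa [ENNReal.toReal_ofReal] using this

lemma ae_hasSum_coefficient :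
    ∀ᵐ z ∂(coefficientMeasure ρ),
      HasSum (fun n => z n • ρ.eigenbasis n) (∑' n, z n • ρ.eigenbasis n) := by
  filter_upwards [ae_summable_norm_sq_coefficient ρ] with z hz
  exact (hilbertBasis_summable_smul ρ.eigenbasis hz).1.hasSum

variable [MeasurableSpace H] [BorelSpace H]

/-- The `tsum` takes a default value where the series diverges; off that null set it is the limit of
measurable finite sums. -/
lemma aemeasurable_tsum_coefficient :
    AEMeasurable (fun z : ρ.eigenIndex → ℂ => ∑' n, z n • ρ.eigenbasis n)
      (coefficientMeasure ρ) := by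
  have : SecondCountableTopology H := UniformSpace.secondCountable_of_separable H
  refine aemeasurable_of_tendsto_metrizable_ae Filter.atTop (f := fun F z =>
    ∑ n ∈ F, z n • ρ.eigenbasis n) (fun F => Measurable.aemeasurable (by fun_prop)) ?_
  filter_upwards [ae_hasSum_coefficient ρ] with z hz
  simpa [HasSum] using hz

lemma lintegral_norm_sq_gaussianMeasure :
    ∫⁻ ψ, ENNReal.ofReal (‖ψ‖ ^ 2) ∂(gaussianMeasure ρ) = 1 := by
  rw [gaussianMeasure, lintegral_map' (by fun_prop) (aemeasurable_tsum_coefficient ρ),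
    ← lintegral_tsum_norm_sq_coefficient ρ]
  refine lintegral_congr_ae ?_
  filter_upwards [ae_summable_norm_sq_coefficient ρ] with z hz
  rw [(hilbertBasis_summable_smul ρ.eigenbasis hz).2,
    ENNReal.ofReal_tsum_of_nonneg (fun _ => by positivity) hz]

/-- Fatou's lemma along the finite subsets of the eigenbasis: the bounds for the partial sums
converge, since both the expectation series and `∑ p n = 1` do. -/
theorem lintegral_exp_inner_gaussianMeasure_le {D : H →L[ℂ] H}
    (hD : (D : H →ₗ[ℂ] H).IsSymmetric) (hrD : ‖ρ.op‖ * ‖D‖ ≤ 1 / 2) {τ : ℝ}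
    (hτ : HasSum (fun n => ρ.eigenvalue n *
      (inner ℂ (ρ.eigenbasis n) (D (ρ.eigenbasis n))).re) τ) :
    ∫⁻ ψ, ENNReal.ofReal (Real.exp (inner ℂ ψ (D ψ)).re) ∂(gaussianMeasure ρ) ≤
      ENNReal.ofReal (Real.exp (τ + ‖ρ.op‖ * ‖D‖ ^ 2)) := by
  have hcont : Continuous fun ψ : H => ENNReal.ofReal (Real.exp (inner ℂ ψ (D ψ)).re) :=
    ENNReal.continuous_ofReal.comp (by fun_prop)
  have hsecond : SecondCountableTopology H := UniformSpace.secondCountable_of_separable H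
  rw [gaussianMeasure, lintegral_map' hcont.aemeasurable (aemeasurable_tsum_coefficient ρ)]
  let f : Finset ρ.eigenIndex → (ρ.eigenIndex → ℂ) → ℝ≥0∞ := fun F z =>
    ENNReal.ofReal (Real.exp (inner ℂ (∑ n ∈ F, z n • ρ.eigenbasis n)
      (D (∑ n ∈ F, z n • ρ.eigenbasis n))).re)
  have hfm : ∀ F, Measurable (f F) := fun F => hcont.measurable.comp (by fun_prop)
  have hlim : ∀ᵐ z ∂(coefficientMeasure ρ), ENNReal.ofReal (Real.exp
      (inner ℂ (∑' n, z n • ρ.eigenbasis n) (D (∑' n, z n • ρ.eigenbasis n))).re) =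
      Filter.liminf (fun F => f F z) Filter.atTop := by
    filter_upwards [ae_hasSum_coefficient ρ] with z hz
    exact ((hcont.tendsto _).comp hz).liminf_eq.symm
  rw [lintegral_congr_ae hlim]
  refine (lintegral_liminf_le hfm).trans ?_
  have hF : ∀ F, ∫⁻ z, f F z ∂(coefficientMeasure ρ) ≤ ENNReal.ofReal (Real.exp
      (∑ n ∈ F, ρ.eigenvalue n * (inner ℂ (ρ.eigenbasis n) (D (ρ.eigenbasis n))).re +
        ‖ρ.op‖ * ‖D‖ ^ 2 * ∑ n ∈ F, (ρ.eigenvalue n : ℝ))) := by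
    intro F
    have h := lintegral_exp_inner_sum_complexGaussian_le
      (e := fun n : F => ρ.eigenbasis n)
      (ρ.eigenbasis.orthonormal.comp _ Subtype.val_injective) (fun n : F => ρ.eigenvalue n)
      (fun n => ρ.eigenvalue_le_norm n) (norm_nonneg _) hD hrD
    have hcontF : Continuous fun z : F → ℂ => ENNReal.ofReal (Real.exp
        (inner ℂ (∑ n, z n • ρ.eigenbasis n) (D (∑ n, z n • ρ.eigenbasis n))).re) :=
      hcont.comp (g := fun ψ : H => ENNReal.ofReal (Real.exp (inner ℂ ψ (D ψ)).re)) (by fun_prop)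
    rw [← lintegral_restrict_infinitePi (μ := fun n => complexGaussian (ρ.eigenvalue n))
      hcontF.measurable] at h
    rw [Finset.sum_coe_sort F (fun n => (ρ.eigenvalue n : ℝ)), Finset.sum_coe_sort F
      (fun n => ρ.eigenvalue n * (inner ℂ (ρ.eigenbasis n) (D (ρ.eigenbasis n))).re)] at h
    refine le_trans (le_of_eq ?_) h
    refine lintegral_congr fun z => ?_
    simp only [f, Finset.restrict]
    rw [Finset.sum_coe_sort F (fun n => z n • ρ.eigenbasis n)]
  refine (Filter.liminf_le_liminf (Filter.Eventually.of_forall hF)).trans_eq ?_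
  refine Filter.Tendsto.liminf_eq ?_
  refine ENNReal.tendsto_ofReal ((Real.continuous_exp.tendsto _).comp ?_)
  have h := hτ.add (ρ.hasSum_eigenvalue.mul_left (‖ρ.op‖ * ‖D‖ ^ 2))
  simpa [HasSum, Finset.sum_add_distrib, Finset.mul_sum] using h

end Hilbert

/-! ### Concentration of expectation values under GAP -/

section Concentration

variable {H : Type*} [NormedAddCommGroup H] [InnerProductSpace ℂ H]

lemma abs_re_inner_apply_le (T : H →L[ℂ] H) (ψ : H) : |(inner ℂ ψ (T ψ)).re| ≤ ‖T‖ * ‖ψ‖ ^ 2 := by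
  refine (Complex.abs_re_le_norm _).trans ((norm_inner_le_norm _ _).trans ?_)
  calc ‖ψ‖ * ‖T ψ‖ ≤ ‖ψ‖ * (‖T‖ * ‖ψ‖) := by gcongr; exact T.le_opNorm ψ
    _ = _ := by ring

lemma re_inner_normalize (T : H →L[ℂ] H) (ψ : H) :
    (inner ℂ (((‖ψ‖⁻¹ : ℝ) : ℂ) • ψ) (T (((‖ψ‖⁻¹ : ℝ) : ℂ) • ψ))).re =
      (‖ψ‖ ^ 2)⁻¹ * (inner ℂ ψ (T ψ)).re := by
  rw [map_smul, inner_smul_left, inner_smul_right, ← mul_assoc, Complex.conj_ofReal,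
    ← Complex.ofReal_mul, Complex.re_ofReal_mul]
  congr 1
  rw [sq, mul_inv]

lemma measurable_normalize [TopologicalSpace.SeparableSpace H] [MeasurableSpace H] [BorelSpace H] :
    Measurable fun ψ : H => ((‖ψ‖⁻¹ : ℝ) : ℂ) • ψ := by
  have : SecondCountableTopology H := UniformSpace.secondCountable_of_separable H
  fun_prop

variable [CompleteSpace H]

/-- The self-adjoint operator with quadratic form `t * Re ⟪ψ, T ψ⟫ + c * ‖ψ‖ ^ 2`. -/
noncomputable def tilted (T : H →L[ℂ] H) (t c : ℝ) : H →L[ℂ] H :=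
  ((t / 2 : ℝ) : ℂ) • (T + ContinuousLinearMap.adjoint T) + (c : ℂ) • ContinuousLinearMap.id ℂ H

lemma tilted_isSymmetric (T : H →L[ℂ] H) (t c : ℝ) :
    (tilted T t c : H →ₗ[ℂ] H).IsSymmetric := by
  intro x y
  simp only [tilted, ContinuousLinearMap.coe_coe, add_apply, smul_apply, ContinuousLinearMap.id_apply,
    inner_add_left, inner_add_right, inner_smul_left, inner_smul_right, Complex.conj_ofReal,
    ContinuousLinearMap.adjoint_inner_left, ContinuousLinearMap.adjoint_inner_right]
  ring

lemma re_inner_tilted (T : H →L[ℂ] H) (t c : ℝ) (ψ : H) :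
    (inner ℂ ψ (tilted T t c ψ)).re = t * (inner ℂ ψ (T ψ)).re + c * ‖ψ‖ ^ 2 := by
  have h : inner ℂ ψ ψ = ((‖ψ‖ ^ 2 : ℝ) : ℂ) := by
    rw [inner_self_eq_norm_sq_to_K]
    norm_cast
  simp only [tilted, add_apply, smul_apply, ContinuousLinearMap.id_apply,
    inner_add_right, inner_smul_right, ContinuousLinearMap.adjoint_inner_right,
    Complex.add_re, Complex.re_ofReal_mul]
  rw [← inner_conj_symm (T ψ) ψ, Complex.conj_re, h, Complex.ofReal_re]
  ring

lemma norm_tilted_le (T : H →L[ℂ] H) {t : ℝ} (ht : 0 ≤ t) (c : ℝ) :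
    ‖tilted T t c‖ ≤ t * ‖T‖ + |c| := by
  refine (norm_add_le _ _).trans ?_
  rw [norm_smul, norm_smul, Complex.norm_real, Complex.norm_real, Real.norm_eq_abs,
    Real.norm_eq_abs, abs_of_nonneg (by positivity : 0 ≤ t / 2)]
  have h1 : ‖T + ContinuousLinearMap.adjoint T‖ ≤ ‖T‖ + ‖T‖ :=
    (norm_add_le _ _).trans (by rw [LinearIsometryEquiv.norm_map])
  have h2 : |c| * ‖ContinuousLinearMap.id ℂ H‖ ≤ |c| * 1 := by
    gcongr
    exact ContinuousLinearMap.norm_id_le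
  have h3 : t / 2 * ‖T + ContinuousLinearMap.adjoint T‖ ≤ t / 2 * (‖T‖ + ‖T‖) := by gcongr
  linarith

variable (ρ : DensityMatrix H)

lemma abs_expectation_le_one {T : H →L[ℂ] H} (hT : ‖T‖ ≤ 1) {β : ℝ}
    (hβ : HasSum (fun n => ρ.eigenvalue n *
      (inner ℂ (ρ.eigenbasis n) (T (ρ.eigenbasis n))).re) β) : |β| ≤ 1 := by
  have h : ∀ n, |(inner ℂ (ρ.eigenbasis n) (T (ρ.eigenbasis n))).re| ≤ 1 := by
    intro n
    have := abs_re_inner_apply_le T (ρ.eigenbasis n)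
    rw [ρ.eigenbasis.orthonormal.1] at this
    linarith
  refine abs_le.2 ⟨?_, ?_⟩
  · refine hasSum_le (fun n => ?_) ρ.hasSum_eigenvalue.neg hβ
    nlinarith [(abs_le.1 (h n)).1, (ρ.eigenvalue n).coe_nonneg]
  · refine hasSum_le (fun n => ?_) hβ ρ.hasSum_eigenvalue
    nlinarith [(abs_le.1 (h n)).2, (ρ.eigenvalue n).coe_nonneg]

variable [TopologicalSpace.SeparableSpace H] [MeasurableSpace H] [BorelSpace H]

/-- Dropping the constraint to the sphere costs only an inequality, which is enough for tail bounds.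
-/
lemma GAP_preimage_le {U : Set H} (hU : MeasurableSet U) :
    GAP ρ (Subtype.val ⁻¹' U) ≤
      ∫⁻ ψ in (fun ψ : H => ((‖ψ‖⁻¹ : ℝ) : ℂ) • ψ) ⁻¹' U, ENNReal.ofReal (‖ψ‖ ^ 2)
        ∂(gaussianMeasure ρ) := by
  rw [GAP, (MeasurableEmbedding.subtype_coe Metric.isClosed_sphere.measurableSet).comap_apply,
    ← withDensity_apply _ (measurable_normalize hU)]
  refine (measure_mono (Set.image_preimage_subset _ _)).trans ?_
  rw [Measure.map_apply measurable_normalize hU]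
  rfl

theorem isProbabilityMeasure_GAP : IsProbabilityMeasure (GAP ρ) := by
  have hS : MeasurableSet (Metric.sphere (0 : H) 1) := Metric.isClosed_sphere.measurableSet
  refine ⟨?_⟩
  rw [GAP, (MeasurableEmbedding.subtype_coe hS).comap_apply, Set.image_univ, Subtype.range_coe,
    Measure.map_apply measurable_normalize hS, gaussianAdjusted,
    withDensity_apply _ (measurable_normalize hS), ← lintegral_indicator (measurable_normalize hS),
    ← lintegral_norm_sq_gaussianMeasure ρ]
  refine lintegral_congr fun ψ => ?_
  -- Normalising `0` gives `0`, off the sphere, but the weight `‖ψ‖²` vanishes there.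
  by_cases h : ψ = 0
  · simp [h]
  · rw [Set.indicator_of_mem]
    simp [norm_smul, h]

/-- Chernoff bound with parameter `t`, the density `‖ψ‖²` and the normalisation both being absorbed
into the quadratic form of `tilted T t c`. -/
theorem GAP_lt_sub_le_exp {T : H →L[ℂ] H} (hT : ‖T‖ ≤ 1) {β : ℝ}
    (hβ : HasSum (fun n => ρ.eigenvalue n *
      (inner ℂ (ρ.eigenbasis n) (T (ρ.eigenbasis n))).re) β) {s : ℝ} (hs : 0 ≤ s) (hs2 : s ≤ 2)
    {t : ℝ} (ht : 0 ≤ t) (hrt : ‖ρ.op‖ * (4 * t + 1) ≤ 1 / 2) :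
    GAP ρ {ψ | s < (inner ℂ (ψ : H) (T ψ)).re - β} ≤
      ENNReal.ofReal (Real.exp (-(t * s) + ‖ρ.op‖ * (4 * t + 1) ^ 2)) := by
  have hU : MeasurableSet {ψ : H | s < (inner ℂ ψ (T ψ)).re - β} :=
    (isOpen_lt continuous_const (by fun_prop)).measurableSet
  have hβ1 := abs_le.1 (abs_expectation_le_one ρ hT hβ)
  -- The `1` pays for the weight, via `‖ψ‖² ≤ exp (‖ψ‖² - 1)`; the term `-t (β + s)` is the
  -- homogenised threshold.
  set c : ℝ := 1 - t * (β + s) with hc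
  have hnorm : ‖tilted T t c‖ ≤ 4 * t + 1 := by
    refine (norm_tilted_le T ht c).trans ?_
    have h1 : t * ‖T‖ ≤ t * 1 := by gcongr
    have h2 : |c| ≤ 1 + t * 3 := by
      rw [abs_le, hc]
      constructor <;> nlinarith
    linarith
  -- The expectation is `tβ + c = 1 - ts`; its `1` later cancels the prefactor `exp (-1)`.
  have hτ : HasSum (fun n => ρ.eigenvalue n *
      (inner ℂ (ρ.eigenbasis n) (tilted T t c (ρ.eigenbasis n))).re) (1 - t * s) := by
    have h := (hβ.mul_left t).add (ρ.hasSum_eigenvalue.mul_left c)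
    convert! h using 1
    · ext n
      rw [re_inner_tilted, ρ.eigenbasis.orthonormal.1]
      ring
    · rw [hc]
      ring
  have hexp := lintegral_exp_inner_gaussianMeasure_le ρ (tilted_isSymmetric T t c)
    ((mul_le_mul_of_nonneg_left hnorm (norm_nonneg _)).trans hrt) hτ
  refine (GAP_preimage_le ρ hU).trans ?_
  rw [← lintegral_indicator (measurable_normalize hU)]
  calc _ ≤ ∫⁻ ψ, ENNReal.ofReal (Real.exp (-1)) *
        ENNReal.ofReal (Real.exp (inner ℂ ψ (tilted T t c ψ)).re) ∂(gaussianMeasure ρ) := by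
        refine lintegral_mono fun ψ => Set.indicator_apply_le' (fun hψ => ?_) (fun _ => zero_le)
        rw [← ENNReal.ofReal_mul (Real.exp_pos _).le, ← Real.exp_add, re_inner_tilted]
        refine ENNReal.ofReal_le_ofReal ?_
        rcases eq_or_ne ψ 0 with rfl | h0
        · simp [Real.exp_nonneg]
        have hn : 0 < ‖ψ‖ ^ 2 := by positivity
        simp only [Set.mem_preimage, Set.mem_ofPred_eq, re_inner_normalize] at hψ
        have h1 : (β + s) * ‖ψ‖ ^ 2 ≤ (inner ℂ ψ (T ψ)).re := by
          have : β + s < (inner ℂ ψ (T ψ)).re / ‖ψ‖ ^ 2 := by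
            rw [div_eq_inv_mul]
            linarith
          exact ((lt_div_iff₀ hn).1 this).le
        have h2 : ‖ψ‖ ^ 2 - 1 ≤ -1 + (t * (inner ℂ ψ (T ψ)).re + c * ‖ψ‖ ^ 2) := by
          rw [hc]
          nlinarith [mul_le_mul_of_nonneg_left h1 ht]
        have h3 := Real.add_one_le_exp (‖ψ‖ ^ 2 - 1)
        have h4 := Real.exp_le_exp.2 h2
        linarith
    _ ≤ ENNReal.ofReal (Real.exp (-1)) *
        ENNReal.ofReal (Real.exp (1 - t * s + ‖ρ.op‖ * ‖tilted T t c‖ ^ 2)) := by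
        rw [lintegral_const_mul' _ _ ENNReal.ofReal_ne_top]
        gcongr
    _ ≤ _ := by
        rw [← ENNReal.ofReal_mul (Real.exp_pos _).le, ← Real.exp_add]
        refine ENNReal.ofReal_le_ofReal (Real.exp_le_exp.2 ?_)
        have : ‖ρ.op‖ * ‖tilted T t c‖ ^ 2 ≤ ‖ρ.op‖ * (4 * t + 1) ^ 2 := by gcongr
        linarith

/-- Concentration of the expectation value `Re ⟪ψ, T ψ⟫` about `Re tr (ρ T)`. -/
theorem GAP_concentration {T : H →L[ℂ] H} (hT : ‖T‖ ≤ 1) {β : ℝ}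
    (hβ : HasSum (fun n => ρ.eigenvalue n *
      (inner ℂ (ρ.eigenbasis n) (T (ρ.eigenbasis n))).re) β) {s : ℝ} (hs : 0 ≤ s) :
    GAP ρ {ψ | s < (inner ℂ (ψ : H) (T ψ)).re - β} ≤
      ENNReal.ofReal (3 * Real.exp (-(s ^ 2 / (128 * ‖ρ.op‖)))) := by
  have hr := ρ.norm_op_pos
  set r := ‖ρ.op‖ with hr_def
  -- Both expectation values lie in `[-1, 1]`, so deviations beyond `2` do not occur.
  rcases lt_or_ge 2 s with hs2 | hs2
  · have hempty : {ψ : Metric.sphere (0 : H) 1 | s < (inner ℂ (ψ : H) (T ψ)).re - β} = ∅ := by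
      refine Set.eq_empty_of_forall_notMem fun ψ hψ => ?_
      have h1 := (abs_le.1 (abs_re_inner_apply_le T (ψ : H))).2
      have h2 := (abs_le.1 (abs_expectation_le_one ρ hT hβ)).1
      rw [norm_eq_of_mem_sphere ψ] at h1
      simp only [Set.mem_ofPred_eq] at hψ
      linarith
    rw [hempty, measure_empty]
    exact zero_le
  -- For `r > 3/8` the right-hand side exceeds `1`. Otherwise `t = s/(64r)` is admissible: `4rt =
  -- s/16 ≤ 1/8`, so `r (4t + 1) ≤ 1/2`.
  rcases lt_or_ge (3 / 8) r with hr2 | hr2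
  · have := isProbabilityMeasure_GAP ρ
    refine prob_le_one.trans ?_
    rw [← ENNReal.ofReal_one]
    refine ENNReal.ofReal_le_ofReal ?_
    have h1 : s ^ 2 / (128 * r) ≤ 1 / 2 := by
      rw [div_le_iff₀ (by positivity)]
      nlinarith
    have h2 := Real.add_one_le_exp (-(s ^ 2 / (128 * r)))
    linarith
  · have ht : 0 ≤ s / (64 * r) := by positivity
    have hrt : r * (s / (64 * r)) = s / 64 := by field_simp
    refine (GAP_lt_sub_le_exp ρ hT hβ hs hs2 ht (by rw [← hr_def]; nlinarith)).trans
      (ENNReal.ofReal_le_ofReal ?_)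
    -- From `(4t + 1)² ≤ 2(16t² + 1)` the exponent is at most `-ts + 32rt² + 2r`, and `t = s/(64r)`
    -- minimises it. The leftover `exp (2r) ≤ e < 3` is the constant `3`.
    have h1 : -(s / (64 * r) * s) + r * (4 * (s / (64 * r)) + 1) ^ 2 ≤
        2 * r + -(s ^ 2 / (128 * r)) := by
      have h2 : (4 * (s / (64 * r)) + 1) ^ 2 ≤ 2 * (16 * (s / (64 * r)) ^ 2 + 1) := by
        nlinarith [sq_nonneg (4 * (s / (64 * r)) - 1)]
      have h3 : r * (4 * (s / (64 * r)) + 1) ^ 2 ≤ r * (2 * (16 * (s / (64 * r)) ^ 2 + 1)) := by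
        gcongr
      have h4 : r * (2 * (16 * (s / (64 * r)) ^ 2 + 1)) = s ^ 2 / (128 * r) + 2 * r := by
        field_simp
        ring
      have h5 : s / (64 * r) * s = 2 * (s ^ 2 / (128 * r)) := by
        field_simp
        ring
      linarith
    refine (Real.exp_le_exp.2 h1).trans ?_
    rw [Real.exp_add]
    gcongr
    calc Real.exp (2 * r) ≤ Real.exp 1 := Real.exp_le_exp.2 (by linarith)
      _ ≤ 3 := Real.exp_one_lt_three.le

end Concentration

/-! ### Trace norm via discrete Weyl operators -/

section TraceNorm

/-- Parseval for the unnormalised Fourier transform on `ZMod d`, from orthogonality of characters.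
-/
lemma sum_norm_sq_sum_stdAddChar_mul {d : ℕ} [NeZero d] (f : ZMod d → ℂ) :
    ∑ k, ‖∑ j, ZMod.stdAddChar (k * j) * f j‖ ^ 2 = d * ∑ j, ‖f j‖ ^ 2 := by
  have hsum : ∀ j l : ZMod d, ∑ k, (ZMod.stdAddChar (k * j) * f j) *
      (starRingEnd ℂ) (ZMod.stdAddChar (k * l) * f l) =
        if j = l then (d : ℂ) * (f j * (starRingEnd ℂ) (f j)) else 0 := by
    intro j l
    have h : ∀ k : ZMod d, (ZMod.stdAddChar (k * j) * f j) *
        (starRingEnd ℂ) (ZMod.stdAddChar (k * l) * f l) =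
          ZMod.stdAddChar (k * (j - l)) * (f j * (starRingEnd ℂ) (f l)) := by
      intro k
      rw [mul_sub, AddChar.map_sub_eq_div, map_mul (starRingEnd ℂ),
        ← Complex.inv_eq_conj (AddChar.norm_apply _ _)]
      ring
    simp_rw [h]
    rw [← Finset.sum_mul, AddChar.sum_mulShift _ (ZMod.isPrimitive_stdAddChar d)]
    by_cases hjl : j = l
    · simp [hjl, ZMod.card]
    · simp [hjl, sub_eq_zero]
  have hcomplex : ((∑ k, ‖∑ j, ZMod.stdAddChar (k * j) * f j‖ ^ 2 : ℝ) : ℂ) =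
      ((d * ∑ j, ‖f j‖ ^ 2 : ℝ) : ℂ) := by
    push_cast
    simp_rw [← Complex.mul_conj', map_sum, Finset.sum_mul_sum]
    rw [Finset.sum_comm, Finset.mul_sum]
    refine Finset.sum_congr rfl fun j _ => ?_
    rw [Finset.sum_comm]
    simp_rw [hsum]
    simp
  exact_mod_cast hcomplex

variable {Ha : Type*} [NormedAddCommGroup Ha] [InnerProductSpace ℂ Ha]

/-- The discrete Weyl operator `∑ j, χ (k * j) |e j⟩⟨e (j + a)|` of an orthonormal basis. -/
noncomputable def weyl {d : ℕ} [NeZero d] (e : OrthonormalBasis (ZMod d) ℂ Ha) (a k : ZMod d) :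
    Ha →L[ℂ] Ha :=
  ∑ j, (ZMod.stdAddChar (k * j) : ℂ) • InnerProductSpace.rankOne ℂ (e j) (e (j + a))

variable {d : ℕ} [NeZero d] (e : OrthonormalBasis (ZMod d) ℂ Ha)

lemma inner_weyl_apply (a k i : ZMod d) (x : Ha) :
    inner ℂ (e i) (weyl e a k x) = ZMod.stdAddChar (k * i) * inner ℂ (e (i + a)) x := by
  simp [weyl, sum_apply, orthonormal_iff_ite.1 e.orthonormal]

lemma norm_weyl_le_one (a k : ZMod d) : ‖weyl e a k‖ ≤ 1 := by
  refine ContinuousLinearMap.opNorm_le_bound _ zero_le_one fun x => ?_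
  rw [one_mul]
  refine (sq_le_sq₀ (norm_nonneg _) (norm_nonneg _)).1 (le_of_eq ?_)
  rw [← e.sum_sq_norm_inner_right, ← e.sum_sq_norm_inner_right x]
  simp_rw [inner_weyl_apply, norm_mul, AddChar.norm_apply, one_mul]
  exact Equiv.sum_comp (Equiv.addRight a) fun j => ‖inner ℂ (e j) x‖ ^ 2

/-- For fixed `a`, these traces as functions of `k` are the Fourier transform of the `a`-th cyclic
diagonal of the matrix of `M`. -/
lemma trace_weyl_comp (a k : ZMod d) (M : Ha →L[ℂ] Ha) :
    LinearMap.trace ℂ Ha (weyl e a k ∘L M : Ha →L[ℂ] Ha) =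
      ∑ j, ZMod.stdAddChar (k * j) * inner ℂ (e (j + a)) (M (e j)) := by
  rw [LinearMap.trace_eq_sum_inner _ e]
  exact Finset.sum_congr rfl fun j _ => inner_weyl_apply e a k j (M (e j))

variable [FiniteDimensional ℂ Ha]

/-- Since `‖|M| x‖ = ‖M x‖`, the trace of `|M|` is at most `∑ ‖M (e i)‖`; then Cauchy–Schwarz. -/
lemma traceNorm_le_sqrt_mul_sqrt {ι : Type*} [Fintype ι] (e : OrthonormalBasis ι ℂ Ha)
    (M : Ha →L[ℂ] Ha) :
    traceNorm M ≤ √(Fintype.card ι) * √(∑ i, ‖M (e i)‖ ^ 2) := by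
  set P : Ha →L[ℂ] Ha := CFC.sqrt (star M * M) with hP
  have hPP : P * P = star M * M := CFC.sqrt_mul_sqrt_self _ (star_mul_self_nonneg M)
  have hPpos : P.IsPositive :=
    (ContinuousLinearMap.nonneg_iff_isPositive P).1 (CFC.sqrt_nonneg _)
  have hnorm : ∀ x, ‖P x‖ = ‖M x‖ := by
    intro x
    have h1 : inner ℂ (P x) (P x) = inner ℂ (M x) (M x) := by
      rw [hPpos.inner_left_eq_inner_right, ← mul_apply_eq_comp, hPP,
        mul_apply_eq_comp, ContinuousLinearMap.star_eq_adjoint,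
        ContinuousLinearMap.adjoint_inner_right]
    rw [inner_self_eq_norm_sq_to_K, inner_self_eq_norm_sq_to_K] at h1
    have h2 : ‖P x‖ ^ 2 = ‖M x‖ ^ 2 := by exact_mod_cast h1
    exact (sq_eq_sq₀ (norm_nonneg _) (norm_nonneg _)).1 h2
  have htr : traceNorm M ≤ ∑ i, ‖M (e i)‖ := by
    change (LinearMap.trace ℂ Ha (P : Ha →ₗ[ℂ] Ha)).re ≤ _
    rw [LinearMap.trace_eq_sum_inner _ e, Complex.re_sum]
    refine Finset.sum_le_sum fun i _ => (Complex.re_le_norm _).trans ?_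
    refine (norm_inner_le_norm _ _).trans ?_
    simp [hnorm]
  refine htr.trans ?_
  rw [← Real.sqrt_mul (by positivity)]
  refine Real.le_sqrt_of_sq_le ?_
  simpa using sq_sum_le_card_mul_sum_sq (s := Finset.univ) (f := fun i => ‖M (e i)‖)

/-- Parseval on every cyclic diagonal gives `d ∑ ‖M (e i)‖² = ∑ |tr (W M)|² ≤ d² η²`; comparing
trace and Hilbert–Schmidt norms costs another `√d`. -/
theorem traceNorm_le_of_norm_trace_weyl_le {M : Ha →L[ℂ] Ha} {η : ℝ}
    (h : ∀ a k, ‖LinearMap.trace ℂ Ha (weyl e a k ∘L M : Ha →L[ℂ] Ha)‖ ≤ η) :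
    traceNorm M ≤ d * η := by
  have hη : 0 ≤ η := (norm_nonneg _).trans (h 0 0)
  have hd : (0 : ℝ) < d := by exact_mod_cast NeZero.pos d
  have hHS : ∑ i, ‖M (e i)‖ ^ 2 = ∑ a, ∑ j, ‖inner ℂ (e (j + a)) (M (e j))‖ ^ 2 := by
    rw [Finset.sum_comm]
    refine Finset.sum_congr rfl fun j _ => ?_
    rw [← e.sum_sq_norm_inner_right]
    exact (Equiv.sum_comp (Equiv.addLeft j) fun i => ‖inner ℂ (e i) (M (e j))‖ ^ 2).symm
  have hle : d * ∑ i, ‖M (e i)‖ ^ 2 ≤ d * (d * η ^ 2) := by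
    rw [hHS, Finset.mul_sum]
    simp_rw [← sum_norm_sq_sum_stdAddChar_mul, ← trace_weyl_comp]
    calc _ ≤ ∑ _a : ZMod d, ∑ _k : ZMod d, η ^ 2 := by
          gcongr with a _ k _
          exact h a k
      _ = _ := by simp [ZMod.card]
  refine (traceNorm_le_sqrt_mul_sqrt e M).trans ?_
  rw [ZMod.card, ← Real.sqrt_mul (by positivity)]
  refine Real.sqrt_le_iff.2 ⟨by positivity, hle.trans_eq (by ring)⟩

end TraceNorm

/-! ### Partial trace and its duality with `A ⊗ 1` -/

section PartialTrace

variable {Ha Hb : Type*} [NormedAddCommGroup Ha] [InnerProductSpace ℂ Ha]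
  [NormedAddCommGroup Hb] [InnerProductSpace ℂ Hb]

lemma tensorRight_apply (m : Hb) (x : Ha) : tensorRight m x = x ⊗ₜ[ℂ] m := rfl

variable [FiniteDimensional ℂ Ha]

lemma separableSpace_tensorProduct [TopologicalSpace.SeparableSpace Hb] :
    TopologicalSpace.SeparableSpace (Ha ⊗[ℂ] Hb) := by
  let e := stdOrthonormalBasis ℂ Ha
  let g : (Fin (Module.finrank ℂ Ha) → Hb) → Ha ⊗[ℂ] Hb := fun y => ∑ i, e i ⊗ₜ[ℂ] y i
  have hg : Continuous g := continuous_finsetSum _ fun i _ =>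
    (TensorProduct.mkL ℂ Ha Hb (e i)).continuous.comp (continuous_apply i)
  refine DenseRange.separableSpace (f := g) (Function.Surjective.denseRange fun x => ?_) hg
  induction x using TensorProduct.induction_on with
  | zero => exact ⟨0, by simp [g]⟩
  | add x y hx hy =>
    obtain ⟨u, rfl⟩ := hx
    obtain ⟨v, rfl⟩ := hy
    exact ⟨u + v, by simp [g, TensorProduct.tmul_add, Finset.sum_add_distrib]⟩
  | tmul x y =>
    refine ⟨fun i => inner ℂ (e i) x • y, ?_⟩
    simp only [g]
    conv_rhs => rw [← e.sum_repr' x, TensorProduct.sum_tmul]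
    simp only [TensorProduct.tmul_smul, TensorProduct.smul_tmul']

variable [CompleteSpace Hb]

lemma adjoint_tensorRight_tmul (m y : Hb) (x : Ha) :
    ContinuousLinearMap.adjoint (tensorRight m) (x ⊗ₜ[ℂ] y) = inner ℂ m y • x := by
  refine ext_inner_left ℂ fun v => ?_
  rw [ContinuousLinearMap.adjoint_inner_right, tensorRight_apply, TensorProduct.inner_tmul,
    inner_smul_right, mul_comm]

/-- The resolution of identity `∑ 1 ⊗ |m⟩⟨m| = 1`. Every vector is a finite sum of product vectors,
on which this is the basis expansion in `Hb`. -/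
lemma hasSum_tensorRight_adjoint {w : Set Hb} (b : HilbertBasis w ℂ Hb) (ψ : Ha ⊗[ℂ] Hb) :
    HasSum (fun m => tensorRight (b m) (ContinuousLinearMap.adjoint (tensorRight (b m)) ψ)) ψ := by
  induction ψ using TensorProduct.induction_on with
  | zero => simp [hasSum_zero]
  | add x y hx hy => simpa using hx.add hy
  | tmul x y =>
    have h := (b.hasSum_repr y).mapL (TensorProduct.mkL ℂ Ha Hb x)
    simpa [adjoint_tensorRight_tmul, tensorRight_apply, b.repr_apply_apply,
      TensorProduct.smul_tmul] using h

lemma hasSum_norm_sq_adjoint_tensorRight {w : Set Hb} (b : HilbertBasis w ℂ Hb)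
    (ψ : Ha ⊗[ℂ] Hb) :
    HasSum (fun m => ‖ContinuousLinearMap.adjoint (tensorRight (Ha := Ha) (b m)) ψ‖ ^ 2)
      (‖ψ‖ ^ 2) := by
  have h := Complex.hasSum_re ((hasSum_tensorRight_adjoint b ψ).mapL (innerSL ℂ ψ))
  have h1 : ∀ x : Ha, (inner ℂ x x).re = ‖x‖ ^ 2 := fun x => inner_self_eq_norm_sq (𝕜 := ℂ) x
  have h2 : (inner ℂ ψ ψ).re = ‖ψ‖ ^ 2 := inner_self_eq_norm_sq (𝕜 := ℂ) ψ
  have h3 : ∀ m : w, inner ℂ ψ (tensorRight (b m)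
      (ContinuousLinearMap.adjoint (tensorRight (Ha := Ha) (b m)) ψ)) =
        inner ℂ (ContinuousLinearMap.adjoint (tensorRight (Ha := Ha) (b m)) ψ)
          (ContinuousLinearMap.adjoint (tensorRight (Ha := Ha) (b m)) ψ) := fun m =>
    (ContinuousLinearMap.adjoint_inner_left _ _ _).symm
  simpa only [innerSL_apply_apply, h3, h1, h2] using h

lemma adjoint_comp_rankOne_comp {E F : Type*} [NormedAddCommGroup E] [InnerProductSpace ℂ E]
    [CompleteSpace E] [NormedAddCommGroup F] [InnerProductSpace ℂ F] [CompleteSpace F]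
    (t : E →L[ℂ] F) (ψ : F) :
    ContinuousLinearMap.adjoint t ∘L InnerProductSpace.rankOne ℂ ψ ψ ∘L t =
      InnerProductSpace.rankOne ℂ (ContinuousLinearMap.adjoint t ψ)
        (ContinuousLinearMap.adjoint t ψ) := by
  ext x
  simp [InnerProductSpace.rankOne_apply, ContinuousLinearMap.adjoint_inner_left]

/-- The term `⟨m|_b |ψ⟩⟨ψ| |m⟩_b` of the partial trace of a pure state. -/
noncomputable abbrev pureTerm (ψ : Ha ⊗[ℂ] Hb) (m : Hb) : Ha →L[ℂ] Ha :=
  InnerProductSpace.rankOne ℂ (ContinuousLinearMap.adjoint (tensorRight (Ha := Ha) m) ψ)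
    (ContinuousLinearMap.adjoint (tensorRight (Ha := Ha) m) ψ)

lemma norm_pureTerm (ψ : Ha ⊗[ℂ] Hb) (m : Hb) :
    ‖pureTerm ψ m‖ = ‖ContinuousLinearMap.adjoint (tensorRight (Ha := Ha) m) ψ‖ ^ 2 := by
  rw [InnerProductSpace.norm_rankOne, sq]

/-- The norms of the rank-one terms sum to `‖ψ‖²`, so the series defining the partial trace
converges absolutely and its `tsum` is not the default value. -/
lemma hasSum_reducedDensity (ψ : Ha ⊗[ℂ] Hb) :
    HasSum (fun m : (exists_hilbertBasis ℂ Hb).choose => pureTerm ψ m) (reducedDensity ψ) := by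
  obtain ⟨b, hb⟩ := (exists_hilbertBasis ℂ Hb).choose_spec
  have h := (hasSum_norm_sq_adjoint_tensorRight b ψ).summable
  simp only [hb, ← norm_pureTerm] at h
  have h2 := h.of_norm.hasSum
  simp only [pureTerm, ← adjoint_comp_rankOne_comp] at h2 ⊢
  exact h2

lemma norm_pureTerm_le (ψ : Ha ⊗[ℂ] Hb) (m : (exists_hilbertBasis ℂ Hb).choose) :
    ‖pureTerm ψ (m : Hb)‖ ≤ ‖ψ‖ ^ 2 := by
  obtain ⟨b, hb⟩ := (exists_hilbertBasis ℂ Hb).choose_spec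
  have h := hasSum_norm_sq_adjoint_tensorRight b ψ
  simp only [hb, ← norm_pureTerm] at h
  exact le_hasSum h m fun _ _ => norm_nonneg _

lemma hasSum_norm_pureTerm (ψ : Ha ⊗[ℂ] Hb) :
    HasSum (fun m : (exists_hilbertBasis ℂ Hb).choose => ‖pureTerm ψ (m : Hb)‖) (‖ψ‖ ^ 2) := by
  obtain ⟨b, hb⟩ := (exists_hilbertBasis ℂ Hb).choose_spec
  have h := hasSum_norm_sq_adjoint_tensorRight b ψ
  simpa only [hb, ← norm_pureTerm] using h

variable (ρ : DensityMatrix (Ha ⊗[ℂ] Hb))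

lemma hasSum_adjoint_comp_op_comp (t : Ha →L[ℂ] (Ha ⊗[ℂ] Hb)) (C : ℝ)
    (ht : ∀ n, ‖ContinuousLinearMap.adjoint t (ρ.eigenbasis n)‖ ^ 2 ≤ C) :
    HasSum (fun n => ((ρ.eigenvalue n : ℝ) : ℂ) • InnerProductSpace.rankOne ℂ
      (ContinuousLinearMap.adjoint t (ρ.eigenbasis n))
      (ContinuousLinearMap.adjoint t (ρ.eigenbasis n)))
      (ContinuousLinearMap.adjoint t ∘L ρ.op ∘L t) := by
  have hsum : Summable (fun n => ((ρ.eigenvalue n : ℝ) : ℂ) • InnerProductSpace.rankOne ℂ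
      (ContinuousLinearMap.adjoint t (ρ.eigenbasis n))
      (ContinuousLinearMap.adjoint t (ρ.eigenbasis n))) := by
    refine Summable.of_norm_bounded (ρ.hasSum_eigenvalue.mul_right C).summable fun n => ?_
    rw [norm_smul, InnerProductSpace.norm_rankOne, ← sq, Complex.norm_real,
      Real.norm_of_nonneg (NNReal.coe_nonneg _)]
    exact mul_le_mul_of_nonneg_left (ht n) (NNReal.coe_nonneg _)
  convert hsum.hasSum using 1
  ext x
  have h1 := hsum.hasSum.mapL (ContinuousLinearMap.apply ℂ Ha x)
  have h2 := (ρ.eigenbasis.hasSum_repr (t x)).mapL (ContinuousLinearMap.adjoint t ∘L ρ.op)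
  refine h2.unique (h1.congr_fun fun n => ?_)
  simp only [ContinuousLinearMap.apply_apply, ContinuousLinearMap.comp_apply, map_smul,
    ρ.op_eigenbasis, ρ.eigenbasis.repr_apply_apply, InnerProductSpace.rankOne_apply,
    ContinuousLinearMap.adjoint_inner_left]
  exact smul_comm _ _ _

/-- The partial trace of a density matrix is the mixture of the reduced density matrices of its
eigenvectors. -/
theorem hasSum_partialTrace :
    HasSum (fun n => ((ρ.eigenvalue n : ℝ) : ℂ) • reducedDensity (ρ.eigenbasis n))
      (partialTrace ρ.op) := by
  -- The double family over eigenvectors and basis vectors of `Hb` is absolutely summable, with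
  -- total norm `∑ p n`. Summing it in the two orders gives the two sides.
  let f : ρ.eigenIndex × (exists_hilbertBasis ℂ Hb).choose → (Ha →L[ℂ] Ha) := fun a =>
    ((ρ.eigenvalue a.1 : ℝ) : ℂ) • pureTerm (ρ.eigenbasis a.1) a.2
  have hnorm : ∀ a, ‖f a‖ = ρ.eigenvalue a.1 * ‖pureTerm (ρ.eigenbasis a.1) (a.2 : Hb)‖ := by
    intro a
    rw [norm_smul, Complex.norm_real, Real.norm_of_nonneg (NNReal.coe_nonneg _)]
  have hfib : ∀ n, HasSum (fun m => ‖f (n, m)‖) (ρ.eigenvalue n) := by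
    intro n
    simp only [hnorm]
    have h := (hasSum_norm_pureTerm (ρ.eigenbasis n)).mul_left (ρ.eigenvalue n : ℝ)
    simpa only [ρ.eigenbasis.orthonormal.1, one_pow, mul_one] using h
  have hf : Summable f := by
    refine Summable.of_norm ((summable_prod_of_nonneg fun a => norm_nonneg _).2
      ⟨fun n => (hfib n).summable, ?_⟩)
    simpa only [(hfib _).tsum_eq] using ρ.hasSum_eigenvalue.summable
  have hn : ∀ n, HasSum (fun m => f (n, m))
      (((ρ.eigenvalue n : ℝ) : ℂ) • reducedDensity (ρ.eigenbasis n)) :=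
    fun n => (hasSum_reducedDensity (ρ.eigenbasis n)).const_smul _
  have hm : ∀ m, HasSum (fun n => f (n, m))
      (ContinuousLinearMap.adjoint (tensorRight (m : Hb)) ∘L ρ.op ∘L tensorRight (m : Hb)) := by
    intro m
    refine hasSum_adjoint_comp_op_comp ρ (tensorRight (m : Hb)) 1 fun n => ?_
    have h := norm_pureTerm_le (ρ.eigenbasis n) m
    rwa [norm_pureTerm, ρ.eigenbasis.orthonormal.1, one_pow] at h
  have h1 := hf.hasSum.prod_fiberwise hn
  have h2 := ((Equiv.prodComm _ _).hasSum_iff.2 hf.hasSum).prod_fiberwise hm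
  rw [partialTrace, h2.tsum_eq]
  exact h1

/-- The linear functional `M ↦ tr (A M)`. -/
noncomputable def traceMul (A : Ha →L[ℂ] Ha) : (Ha →L[ℂ] Ha) →L[ℂ] ℂ :=
  LinearMap.toContinuousLinearMap
    { toFun := fun M => LinearMap.trace ℂ Ha (A ∘L M : Ha →L[ℂ] Ha)
      map_add' := fun M N => by simp
      map_smul' := fun c M => by simp }

lemma traceMul_apply (A M : Ha →L[ℂ] Ha) :
    traceMul A M = LinearMap.trace ℂ Ha (A ∘L M : Ha →L[ℂ] Ha) := rfl

lemma traceMul_rankOne (A : Ha →L[ℂ] Ha) (u v : Ha) :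
    traceMul A (InnerProductSpace.rankOne ℂ u v) = inner ℂ v (A u) := by
  have h : A ∘L InnerProductSpace.rankOne ℂ u v = InnerProductSpace.rankOne ℂ (A u) v := by
    ext x
    simp [InnerProductSpace.rankOne_apply]
  rw [traceMul_apply, h, InnerProductSpace.trace_rankOne]

lemma traceMul_smul (c : ℂ) (A M : Ha →L[ℂ] Ha) : traceMul (c • A) M = c * traceMul A M := by
  simp [traceMul_apply]

/-- The duality defining the partial trace, which turns statements on `ρ_a^ψ` into expectation
values of `A ⊗ 1`. Both sides are expanded over the same basis of `Hb` and agree term by term. -/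
lemma traceMul_reducedDensity (A : Ha →L[ℂ] Ha) (ψ : Ha ⊗[ℂ] Hb) :
    traceMul A (reducedDensity ψ) = inner ℂ ψ (A.rTensor Hb ψ) := by
  obtain ⟨b, hb⟩ := (exists_hilbertBasis ℂ Hb).choose_spec
  have h1 := (hasSum_reducedDensity ψ).mapL (traceMul A)
  have h2 := (hasSum_tensorRight_adjoint b ψ).mapL (innerSL ℂ ψ ∘L A.rTensor Hb)
  refine h1.unique (h2.congr_fun fun m => ?_)
  rw [traceMul_rankOne, ContinuousLinearMap.adjoint_inner_left, hb]
  rfl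

lemma hasSum_re_traceMul_partialTrace (A : Ha →L[ℂ] Ha) :
    HasSum (fun n => ρ.eigenvalue n *
      (inner ℂ (ρ.eigenbasis n) (A.rTensor Hb (ρ.eigenbasis n))).re)
      (traceMul A (partialTrace ρ.op)).re := by
  have h := Complex.hasSum_re ((hasSum_partialTrace ρ).mapL (traceMul A))
  simpa only [map_smul, smul_eq_mul, Complex.re_ofReal_mul, traceMul_reducedDensity] using h

end PartialTrace

/-! ### Union bound and the main estimate -/

section Typicality

/-- Otherwise the real and imaginary parts of `z` are both at most `s` in absolute value. This
reduces a complex trace to four one-sided real tails. -/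
lemma exists_lt_re_I_pow_mul {z : ℂ} {s : ℝ} (hz : √2 * s < ‖z‖) :
    ∃ i : Fin 4, s < (Complex.I ^ (i : ℕ) * z).re := by
  by_contra! h
  have h0 := h 0
  have h1 := h 1
  have h2 := h 2
  have h3 := h 3
  simp [pow_succ, Complex.mul_re] at h0 h1 h2 h3
  have hs : 0 ≤ s := by linarith
  have hsq : ‖z‖ ^ 2 ≤ (√2 * s) ^ 2 := by
    rw [Complex.sq_norm, Complex.normSq_apply, mul_pow, Real.sq_sqrt zero_le_two]
    nlinarith
  exact absurd ((sq_le_sq₀ (norm_nonneg _) (by positivity)).1 hsq) (not_le.2 hz)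

variable {Ha Hb : Type*} [NormedAddCommGroup Ha] [InnerProductSpace ℂ Ha] [FiniteDimensional ℂ Ha]
  [NormedAddCommGroup Hb] [InnerProductSpace ℂ Hb] [CompleteSpace Hb]

/-- On the zero space no operator has trace `1`. Positivity of the dimension makes `ZMod d` a finite
index set. -/
lemma finrank_pos_of_densityMatrix (ρ : DensityMatrix (Ha ⊗[ℂ] Hb)) :
    0 < Module.finrank ℂ Ha := by
  by_contra! h
  have : Subsingleton Ha := Module.finrank_zero_iff.1 (Nat.le_zero.1 h)
  have h0 : ρ.op = 0 := by
    ext x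
    exact Subsingleton.elim _ _
  have := ρ.norm_op_pos
  rw [h0, norm_zero] at this
  exact lt_irrefl _ this

variable [TopologicalSpace.SeparableSpace Hb] [MeasurableSpace (Ha ⊗[ℂ] Hb)]
  [BorelSpace (Ha ⊗[ℂ] Hb)] (ρ : DensityMatrix (Ha ⊗[ℂ] Hb))

lemma GAP_lt_re_traceMul_le {A : Ha →L[ℂ] Ha} (hA : ‖A‖ ≤ 1) {s : ℝ} (hs : 0 ≤ s) :
    GAP ρ {ψ | s < (traceMul A (reducedDensity (ψ : Ha ⊗[ℂ] Hb) - partialTrace ρ.op)).re} ≤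
      ENNReal.ofReal (3 * Real.exp (-(s ^ 2 / (128 * ‖ρ.op‖)))) := by
  have := separableSpace_tensorProduct (Ha := Ha) (Hb := Hb)
  have h := GAP_concentration ρ ((A.norm_rTensor_le (G := Hb)).trans hA)
    (hasSum_re_traceMul_partialTrace ρ A) hs
  simpa only [map_sub, Complex.sub_re, traceMul_reducedDensity] using h

theorem GAP_lt_traceNorm_le {d : ℕ} (hd : Module.finrank ℂ Ha = d) {ε : ℝ} (hε : 0 ≤ ε) :
    GAP ρ {ψ | ε < traceNorm (reducedDensity (ψ : Ha ⊗[ℂ] Hb) - partialTrace ρ.op)} ≤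
      ENNReal.ofReal (12 * (d : ℝ) ^ 2 * Real.exp (-(ε ^ 2 / (256 * d ^ 2 * ‖ρ.op‖)))) := by
  have hd0 : 0 < d := hd ▸ finrank_pos_of_densityMatrix ρ
  have : NeZero d := ⟨hd0.ne'⟩
  have hdR : (0 : ℝ) < d := by exact_mod_cast hd0
  have hr := ρ.norm_op_pos
  let e : OrthonormalBasis (ZMod d) ℂ Ha :=
    (stdOrthonormalBasis ℂ Ha).reindex ((finCongr hd).trans (ZMod.finEquiv d).toEquiv)
  -- Chosen so that `d · (√2 s) = ε`: the `√2` comes from the four phases, the `d` from the Weyl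
  -- bound. It turns `128` into `256d²`.
  let s : ℝ := ε / (√2 * d)
  have hs : 0 ≤ s := by positivity
  let A : ZMod d × ZMod d × Fin 4 → (Ha →L[ℂ] Ha) := fun a =>
    (Complex.I ^ (a.2.2 : ℕ)) • weyl e a.1 a.2.1
  have hA : ∀ a, ‖A a‖ ≤ 1 := by
    intro a
    rw [norm_smul, norm_pow, Complex.norm_I, one_pow, one_mul]
    exact norm_weyl_le_one e _ _
  have hsub : {ψ : Metric.sphere (0 : Ha ⊗[ℂ] Hb) 1 |
        ε < traceNorm (reducedDensity (ψ : Ha ⊗[ℂ] Hb) - partialTrace ρ.op)} ⊆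
      ⋃ a, {ψ | s < (traceMul (A a)
        (reducedDensity (ψ : Ha ⊗[ℂ] Hb) - partialTrace ρ.op)).re} := by
    intro ψ hψ
    by_contra hcon
    simp only [Set.mem_iUnion, Set.mem_ofPred_eq, not_exists, not_lt] at hcon hψ
    refine absurd (traceNorm_le_of_norm_trace_weyl_le e (η := √2 * s)
      (M := reducedDensity (ψ : Ha ⊗[ℂ] Hb) - partialTrace ρ.op) fun a k => ?_) (not_le.2 ?_)
    · by_contra! hlt
      rw [← traceMul_apply] at hlt
      obtain ⟨i, hi⟩ := exists_lt_re_I_pow_mul hlt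
      rw [← traceMul_smul] at hi
      exact absurd (hcon (a, k, i)) (not_le.2 hi)
    · have : (d : ℝ) * (√2 * s) = ε := by
        simp only [s]
        field_simp
      rwa [this]
  refine (measure_mono hsub).trans ((measure_iUnion_fintype_le _ _).trans
    ((Finset.sum_le_sum fun a _ => GAP_lt_re_traceMul_le ρ (hA a) hs).trans (le_of_eq ?_)))
  have hs2 : s ^ 2 / (128 * ‖ρ.op‖) = ε ^ 2 / (256 * d ^ 2 * ‖ρ.op‖) := by
    simp only [s]
    rw [div_pow, mul_pow, Real.sq_sqrt zero_le_two]
    field_simp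
    ring
  rw [Finset.sum_const, nsmul_eq_mul, hs2, ← ENNReal.ofReal_natCast,
    ← ENNReal.ofReal_mul (Nat.cast_nonneg _)]
  congr 1
  simp only [Finset.card_univ, Fintype.card_prod, ZMod.card, Fintype.card_fin]
  push_cast
  ring

end Typicality

end GAPTypicality

open GAPTypicality MeasureTheory
open scoped TensorProduct

theorem theorem1 {Ha Hb : Type*}
    [NormedAddCommGroup Ha] [InnerProductSpace ℂ Ha] [FiniteDimensional ℂ Ha]
    [NormedAddCommGroup Hb] [InnerProductSpace ℂ Hb] [CompleteSpace Hb]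
    [TopologicalSpace.SeparableSpace Hb]
    [MeasurableSpace (Ha ⊗[ℂ] Hb)] [BorelSpace (Ha ⊗[ℂ] Hb)]
    (da : ℕ) (hda : Module.finrank ℂ Ha = da)
    (ρ : DensityMatrix (Ha ⊗[ℂ] Hb)) :
    IsProbabilityMeasure (GAP ρ) ∧
    (∀ δ : ℝ, 0 < δ →
      ENNReal.ofReal (1 - δ) ≤
        GAP ρ {ψ | traceNorm (reducedDensity (ψ : Ha ⊗[ℂ] Hb) - partialTrace ρ.op) ≤
          48 * Real.pi * da * √(Real.log (12 * (da : ℝ) ^ 2 / δ) * ‖ρ.op‖)}) ∧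
    (∀ ε : ℝ, 0 ≤ ε →
      GAP ρ {ψ | ε < traceNorm (reducedDensity (ψ : Ha ⊗[ℂ] Hb) - partialTrace ρ.op)} ≤
        ENNReal.ofReal (12 * (da : ℝ) ^ 2 *
          Real.exp (-((1 / (2304 * Real.pi ^ 2)) * ε ^ 2 / ((da : ℝ) ^ 2 * ‖ρ.op‖))))) := by
  have := separableSpace_tensorProduct (Ha := Ha) (Hb := Hb)
  have hprob := isProbabilityMeasure_GAP ρ
  have hr := ρ.norm_op_pos
  have hd1 : (1 : ℝ) ≤ da := by
    have : 0 < da := hda ▸ finrank_pos_of_densityMatrix ρ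
    exact_mod_cast this
  have htail : ∀ ε : ℝ, 0 ≤ ε →
      GAP ρ {ψ | ε < traceNorm (reducedDensity (ψ : Ha ⊗[ℂ] Hb) - partialTrace ρ.op)} ≤
        ENNReal.ofReal (12 * (da : ℝ) ^ 2 *
          Real.exp (-((1 / (2304 * Real.pi ^ 2)) * ε ^ 2 / ((da : ℝ) ^ 2 * ‖ρ.op‖)))) := by
    intro ε hε
    refine (GAP_lt_traceNorm_le ρ hda hε).trans (ENNReal.ofReal_le_ofReal ?_)
    -- The tail was obtained with `256` in place of `2304π²`, so the stated constant is weaker.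
    have hπ : 256 ≤ 2304 * Real.pi ^ 2 := by nlinarith [Real.pi_gt_three]
    have h : 1 / (2304 * Real.pi ^ 2) * ε ^ 2 / ((da : ℝ) ^ 2 * ‖ρ.op‖) ≤
        ε ^ 2 / (256 * da ^ 2 * ‖ρ.op‖) := by
      have h1 : 1 / (2304 * Real.pi ^ 2) * ε ^ 2 / ((da : ℝ) ^ 2 * ‖ρ.op‖) =
          ε ^ 2 / (2304 * Real.pi ^ 2 * da ^ 2 * ‖ρ.op‖) := by field_simp
      rw [h1]
      gcongr
    gcongr
  refine ⟨hprob, fun δ hδ => ?_, htail⟩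
  rcases le_or_gt 1 δ with hδ1 | hδ1
  · rw [ENNReal.ofReal_of_nonpos (by linarith)]
    exact zero_le
  have hlog : 0 ≤ Real.log (12 * (da : ℝ) ^ 2 / δ) := by
    refine Real.log_nonneg ((one_le_div hδ).2 ?_)
    nlinarith
  set ε := 48 * Real.pi * da * √(Real.log (12 * (da : ℝ) ^ 2 / δ) * ‖ρ.op‖) with hε_def
  have hε : 0 ≤ ε := by positivity
  -- As `48² = 2304`, this `ε` is the one at which the tail bound equals `δ`.
  have hexp : 12 * (da : ℝ) ^ 2 *
      Real.exp (-((1 / (2304 * Real.pi ^ 2)) * ε ^ 2 / ((da : ℝ) ^ 2 * ‖ρ.op‖))) = δ := by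
    have h1 : (1 / (2304 * Real.pi ^ 2)) * ε ^ 2 / ((da : ℝ) ^ 2 * ‖ρ.op‖) =
        Real.log (12 * (da : ℝ) ^ 2 / δ) := by
      rw [hε_def, mul_pow, Real.sq_sqrt (by positivity)]
      field_simp
      norm_num
    rw [h1, Real.exp_neg, Real.exp_log (by positivity)]
    field_simp
  have htail' := htail ε hε
  rw [hexp] at htail'
  -- Subadditivity replaces taking complements, so measurability of the event is not needed.
  have hcover : (1 : ENNReal) ≤
      GAP ρ {ψ | traceNorm (reducedDensity (ψ : Ha ⊗[ℂ] Hb) - partialTrace ρ.op) ≤ ε} +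
        ENNReal.ofReal δ := by
    rw [← measure_univ (μ := GAP ρ)]
    refine le_trans (measure_mono ?_) ((measure_union_le _ _).trans (add_le_add_right htail' _))
    intro ψ _
    exact le_or_gt (traceNorm (reducedDensity (ψ : Ha ⊗[ℂ] Hb) - partialTrace ρ.op)) ε
  rw [ENNReal.ofReal_sub _ hδ.le, ENNReal.ofReal_one]
  exact tsub_le_iff_right.2 hcover
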